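/- Let $l,g,\mu>0$, let $\xi:\mathbb R\to\mathbb R$ be twice differentiable with $\ddot\xi$ Lipschitz, and let $t_0\in\mathbb R$. Consider the inverted pendulum of length $l$ with dry (Coulomb) friction with coefficient $\mu$, gravitational acceleration $g$ and pivot moving along a horizontal line by the law $\xi(t)$; $q\in\mathbb R$ is the angle between the horizontal and the rod ($q=0$ and $q=\pi$ are the horizontal positions), and for $p\neq 0$ the equations of motion are $$\dot q=p,\qquad \dot p=\frac{\ddot\xi(t)}{l}\sin q-\frac{\mu}{l}\left|\ddot\xi(t)\cos q-lp^2+g\sin q\right|\frac{p}{|p|}-\frac{g}{l}\cos q .$$ Write $f(q,p,t)$ for the right-hand side. For every $(q,p,t)$ let $\Phi(q,p,t)\subset\mathbb R^2$ be the smallest closed convex set containing all limit values of $f(q^*,p^*,t)$ as $(q^*,p^*)\to(q,p)$ with $p^*\neq0$. A solution on an interval $I$ is a function $(q,p):I\to\mathbb R^2$ that is absolutely continuous on every compact segment of $I$ and satisfies $(\dot q(t),\dot p(t))\in\Phi(q(t),p(t),t)$ for almost every $t\in I$. Then there exist $q_0\in[0,\pi]$ and $p_0\in\mathbb R$ for which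 there is a solution $(q,p)$ on $[t_0,\infty)$ with $q(t_0)=q_0$, $p(t_0)=p_0$, this solution is unique (every solution with the same initial data on an interval $J\subseteq[t_0,\infty)$ containing $t_0$ coincides with it on $J$), and $q(t)\in[0,\pi]$ for all $t>t_0$. -/

import Mathlib

open Set Filter Topology MeasureTheory

/-- The limit values at `x`, for fixed time `t`, of `f(x*, t)` as `x* → x` with `(x*, t) ∉ M`. -/
def limitValues {E : Type*} [NormedAddCommGroup E]
    (f : E → ℝ → E) (M : Set (E × ℝ)) (x : E) (t : ℝ) : Set E :=
  {y | MapClusterPt y (𝓝[{z | (z, t) ∉ M}] x) (fun z => f z t)}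

/-- Filippov's set-valued right-hand side associated with `ẋ = f(x, t)`, where `M` is the set of
discontinuity points of `f`: the smallest closed convex set containing all limit values. -/
noncomputable def filippov {E : Type*} [NormedAddCommGroup E] [NormedSpace ℝ E]
    (f : E → ℝ → E) (M : Set (E × ℝ)) (x : E) (t : ℝ) : Set E :=
  closedConvexHull ℝ (limitValues f M x t)

/-- `x` is a solution on the interval `I` of the differential inclusion `ẋ ∈ F(x, t)`:
it is absolutely continuous (on every compact segment contained in `I`) and satisfies the
inclusion at almost every `t ∈ I`. Only the values of `x` on `I` matter. -/
def IsInclusionSolution {E : Type*} [NormedAddCommGroup E] [NormedSpace ℝ E]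
    (F : E → ℝ → Set E) (I : Set ℝ) (x : ℝ → E) : Prop :=
  I.OrdConnected ∧
  (∀ a ∈ I, ∀ b ∈ I, AbsolutelyContinuousOnInterval x a b) ∧
  ∀ᵐ t : ℝ, t ∈ I → ∃ v ∈ F (x t) t, HasDerivAt x v t

/-- Right-hand side of the equations of motion, for `p ≠ 0`, of the inverted pendulum of length
`l` with dry friction coefficient `μ`, gravitational acceleration `g` and pivot law `ξ`. The state
is `(q, p)`: the angle between the rod and the horizontal, and the angular velocity. -/
noncomputable def pendulumField (l g μ : ℝ) (ξ : ℝ → ℝ) (x : ℝ × ℝ) (t : ℝ) : ℝ × ℝ :=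
  (x.2,
    deriv (deriv ξ) t / l * Real.sin x.1
      - μ / l * |deriv (deriv ξ) t * Real.cos x.1 - l * x.2 ^ 2 + g * Real.sin x.1|
        * (x.2 / |x.2|)
      - g / l * Real.cos x.1)

/-- The plane `p = 0`, on which the right-hand side is discontinuous. -/
def pendulumPlane : Set ((ℝ × ℝ) × ℝ) := {z | z.1.2 = 0}

/-- Solutions on `I` of the pendulum with dry friction, in Filippov's sense. -/
def IsPendulumSolution (l g μ : ℝ) (ξ : ℝ → ℝ) (I : Set ℝ) (x : ℝ → ℝ × ℝ) : Prop :=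
  IsInclusionSolution (filippov (pendulumField l g μ ξ) pendulumPlane) I x

/-!
The equation has the form `q̇ = p`, `ṗ = A(q, t) - C(q, p, t) sgn p` with a friction `C ≥ 0`, and
Filippov's convexification only replaces `sgn p` by the set-valued sign: the right-hand side at
`p = 0` is the segment between the two one-sided limits (`IsFrictionLaw.mem_filippov_iff`). Apart
from the final section, everything is proved for general `A` and `C` (`IsFrictionLaw`).

*Uniqueness and continuous dependence.* The set-valued sign is monotone and `C ≥ 0`, so in the
squared distance of two solutions the jump of the right-hand side contributes with a favourable
sign, and Grönwall's inequality for absolutely continuous functions gives a Lipschitz estimate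
forward in time (`IsFrictionLaw.comparison`). It needs a bound for the velocities, since `C` is
quadratic in `p`; there is one because friction never adds energy
(`IsFrictionLaw.abs_velocity_le`).

*Existence.* With `sgn p` replaced by `p / ε` truncated to `[-1, 1]` the Picard-Lindelöf theorem
applies (`IsFrictionLaw.exists_approx`). The comparison estimate, which tolerates such an error in
the sign, shows that these approximate solutions converge as `ε → 0`, and the limit is a solution
(`IsFrictionLaw.solution_of_tendsto`).

*Not falling.* At `q = 0` and `q = π` gravity points out of `[0, π]`: `A(0, t) = -g / l < 0` and
`A(π, t) = g / l > 0`. The motion may stick at such a level for a while, when the friction is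
strong enough, but it cannot come back into the interior of `[0, π]`
(`forall_pos_of_decelerating`): an inward velocity would have to grow from `0`, while both gravity
and friction decrease it. Hence a trajectory that starts at rest and leaves `[0, π]` crosses one of
the two levels without having touched the other one (`IsFrictionLaw.escape`). The initial angles for
which it crosses `π`, and those for which it crosses `0`, form two disjoint open sets, containing `π`
and `0` respectively. As `[0, π]` is connected, they do not cover it
(`IsFrictionLaw.exists_trapped_solution`).
-/

/-! ### Absolutely continuous functions -/

theorem AbsolutelyContinuousOnInterval.of_dist_le_add {X Y Z : Type*} [PseudoMetricSpace X]
    [PseudoMetricSpace Y] [PseudoMetricSpace Z] {f : ℝ → X} {u : ℝ → Y} {v : ℝ → Z} {a b : ℝ}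
    (hu : AbsolutelyContinuousOnInterval u a b) (hv : AbsolutelyContinuousOnInterval v a b)
    (h : ∀ s t, dist (f s) (f t) ≤ dist (u s) (u t) + dist (v s) (v t)) :
    AbsolutelyContinuousOnInterval f a b := by
  refine squeeze_zero (fun E ↦ Finset.sum_nonneg fun _ _ ↦ dist_nonneg) (fun E ↦ ?_)
    (by simpa using Tendsto.add hu hv)
  rw [← Finset.sum_add_distrib]
  exact Finset.sum_le_sum fun _ _ ↦ h _ _

theorem AbsolutelyContinuousOnInterval.of_dist_le {X Y : Type*} [PseudoMetricSpace X]
    [PseudoMetricSpace Y] {f : ℝ → X} {u : ℝ → Y} {a b : ℝ}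
    (hu : AbsolutelyContinuousOnInterval u a b) (h : ∀ s t, dist (f s) (f t) ≤ dist (u s) (u t)) :
    AbsolutelyContinuousOnInterval f a b :=
  squeeze_zero (fun _ ↦ Finset.sum_nonneg fun _ _ ↦ dist_nonneg)
    (fun _ ↦ Finset.sum_le_sum fun _ _ ↦ h _ _) hu

theorem AbsolutelyContinuousOnInterval.prodMk {X Y : Type*} [PseudoMetricSpace X]
    [PseudoMetricSpace Y] {u : ℝ → X} {v : ℝ → Y} {a b : ℝ}
    (hu : AbsolutelyContinuousOnInterval u a b) (hv : AbsolutelyContinuousOnInterval v a b) :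
    AbsolutelyContinuousOnInterval (fun t ↦ (u t, v t)) a b :=
  hu.of_dist_le_add hv fun _ _ ↦ max_le_add_of_nonneg dist_nonneg dist_nonneg

theorem AbsolutelyContinuousOnInterval.fst {X Y : Type*} [PseudoMetricSpace X]
    [PseudoMetricSpace Y] {u : ℝ → X × Y} {a b : ℝ} (hu : AbsolutelyContinuousOnInterval u a b) :
    AbsolutelyContinuousOnInterval (fun t ↦ (u t).1) a b :=
  hu.of_dist_le fun _ _ ↦ le_max_left _ _

theorem AbsolutelyContinuousOnInterval.snd {X Y : Type*} [PseudoMetricSpace X]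
    [PseudoMetricSpace Y] {u : ℝ → X × Y} {a b : ℝ} (hu : AbsolutelyContinuousOnInterval u a b) :
    AbsolutelyContinuousOnInterval (fun t ↦ (u t).2) a b :=
  hu.of_dist_le fun _ _ ↦ le_max_right _ _

theorem ContDiff.absolutelyContinuousOnInterval {f : ℝ → ℝ} (hf : ContDiff ℝ 1 f) (a b : ℝ) :
    AbsolutelyContinuousOnInterval f a b := by
  obtain ⟨K, hK⟩ := hf.contDiffOn.exists_lipschitzOnWith (s := uIcc a b) one_ne_zero
    (convex_uIcc a b) isCompact_uIcc
  exact hK.absolutelyContinuousOnInterval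

/-- Mean value inequality for absolutely continuous functions. -/
theorem AbsolutelyContinuousOnInterval.sub_le_of_ae_hasDerivAt_le {f : ℝ → ℝ} {a b v : ℝ}
    (hab : a ≤ b) (hf : AbsolutelyContinuousOnInterval f a b)
    (h : ∀ᵐ t : ℝ, t ∈ Icc a b → ∃ w ≤ v, HasDerivAt f w t) : f b - f a ≤ v * (b - a) := by
  rw [← hf.integral_deriv_eq_sub]
  have : v * (b - a) = ∫ _ in a..b, v := by simp [mul_comm]
  rw [this]
  refine intervalIntegral.integral_mono_ae_restrict hab hf.intervalIntegrable_deriv (by simp) ?_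
  rw [EventuallyLE, ae_restrict_iff' measurableSet_Icc]
  filter_upwards [h] with t ht hmem
  obtain ⟨w, hw, hd⟩ := ht hmem
  exact hd.deriv.trans_le hw

/-- **Grönwall's inequality** for absolutely continuous functions. -/
theorem AbsolutelyContinuousOnInterval.le_exp_mul_of_ae_hasDerivAt_le {f : ℝ → ℝ} {a b K c : ℝ}
    (hab : a ≤ b) (hK : 0 ≤ K) (hc : 0 ≤ c) (hf : AbsolutelyContinuousOnInterval f a b)
    (h : ∀ᵐ t : ℝ, t ∈ Icc a b → ∃ w ≤ K * f t + c, HasDerivAt f w t) :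
    f b ≤ Real.exp (K * (b - a)) * (f a + c * (b - a)) := by
  have hE : ContDiff ℝ 1 fun t : ℝ ↦ Real.exp (-(K * (t - a))) := by fun_prop
  -- `exp (-K (t - a)) f t` grows at a rate of at most `c`, as the exponential is at most `1`
  have key := (hE.absolutelyContinuousOnInterval a b |>.fun_mul hf).sub_le_of_ae_hasDerivAt_le
    (v := c) hab (by
      filter_upwards [h] with t ht hmem
      obtain ⟨w, hw, hd⟩ := ht hmem
      have h1 : HasDerivAt (fun t : ℝ ↦ Real.exp (-(K * (t - a))))
          (Real.exp (-(K * (t - a))) * (-(K * 1))) t :=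
        ((((hasDerivAt_id t).sub_const a).const_mul K).neg).exp
      refine ⟨_, ?_, h1.mul hd⟩
      have h2 : Real.exp (-(K * (t - a))) ≤ 1 := by
        apply Real.exp_le_one_iff.2
        have := mul_nonneg hK (sub_nonneg.2 hmem.1)
        linarith
      have h3 := Real.exp_pos (-(K * (t - a)))
      nlinarith [mul_le_mul_of_nonneg_left hw h3.le, mul_le_mul_of_nonneg_right h2 hc])
  simp only [sub_self, mul_zero, neg_zero, Real.exp_zero, one_mul] at key
  have h4 : Real.exp (K * (b - a)) * Real.exp (-(K * (b - a))) = 1 := by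
    rw [← Real.exp_add]; simp
  calc f b = Real.exp (K * (b - a)) * (Real.exp (-(K * (b - a))) * f b) := by
        rw [← mul_assoc, h4, one_mul]
    _ ≤ _ := by
        apply mul_le_mul_of_nonneg_left _ (Real.exp_pos _).le
        linarith

/-- An upper bound for the derivatives of absolutely continuous functions `f n`, valid in the limit
`n → ∞`, `τ → t`, is inherited by the derivative at `t` of their pointwise limit. The relation `R`
records what is known about the derivatives. -/
theorem le_of_hasDerivAt_of_tendsto {f : ℕ → ℝ → ℝ} {F : ℝ → ℝ} {R : ℕ → ℝ → ℝ → Prop}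
    {a b t d v : ℝ} (ht : t ∈ Ioo a b) (hd : HasDerivAt F d t)
    (hlim : ∀ τ ∈ Icc a b, Tendsto (fun n ↦ f n τ) atTop (𝓝 (F τ)))
    (hac : ∀ n, AbsolutelyContinuousOnInterval (f n) a b)
    (hae : ∀ n, ∀ᵐ τ : ℝ, τ ∈ Icc a b → ∃ w, HasDerivAt (f n) w τ ∧ R n τ w)
    (hR : ∀ η > 0, ∀ᶠ z : ℕ × ℝ in atTop ×ˢ 𝓝 t, ∀ w, R z.1 z.2 w → w ≤ v + η) : d ≤ v := by
  refine le_of_forall_pos_le_add fun η hη ↦ ?_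
  obtain ⟨P, hP, Q, hQ, hPQ⟩ := eventually_prod_iff.1 (hR η hη)
  obtain ⟨r, hr, hrQ⟩ : ∃ r > t, ∀ τ ∈ Icc t r, Q τ := by
    obtain ⟨r, hr, h⟩ := Metric.eventually_nhds_iff.1 hQ
    refine ⟨t + r / 2, by linarith, fun τ hτ ↦ h ?_⟩
    rw [Real.dist_eq, abs_lt]
    constructor <;> linarith [hτ.1, hτ.2]
  have hslope : Tendsto (slope F t) (𝓝[>] t) (𝓝 d) :=
    (hasDerivWithinAt_iff_tendsto_slope' (by simp)).1 hd.hasDerivWithinAt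
  refine le_of_tendsto hslope ?_
  filter_upwards [Ioo_mem_nhdsGT (lt_min hr ht.2)] with τ hτ
  have hτb : τ < b := hτ.2.trans_le (min_le_right _ _)
  have hτr : τ < r := hτ.2.trans_le (min_le_left _ _)
  have hsub : Icc t τ ⊆ Icc a b := Icc_subset_Icc ht.1.le hτb.le
  have hle : F τ - F t ≤ (v + η) * (τ - t) := by
    refine le_of_tendsto ((hlim τ (hsub ⟨hτ.1.le, le_rfl⟩)).sub
      (hlim t (hsub ⟨le_rfl, hτ.1.le⟩))) ?_
    filter_upwards [hP] with n hn
    refine ((hac n).mono ?_).sub_le_of_ae_hasDerivAt_le hτ.1.le ?_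
    · rwa [uIcc_of_le hτ.1.le, uIcc_of_le (ht.1.trans ht.2).le]
    · filter_upwards [hae n] with σ hσ hmem
      obtain ⟨w, hw, hRw⟩ := hσ (hsub hmem)
      exact ⟨w, hPQ hn (hrQ σ ⟨hmem.1, hmem.2.trans hτr.le⟩) w hRw, hw⟩
  rw [slope_def_field, div_le_iff₀ (sub_pos.2 hτ.1)]
  exact hle

/-- The mirror image of `le_of_hasDerivAt_of_tendsto`, for lower bounds. -/
theorem ge_of_hasDerivAt_of_tendsto {f : ℕ → ℝ → ℝ} {F : ℝ → ℝ} {R : ℕ → ℝ → ℝ → Prop}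
    {a b t d v : ℝ} (ht : t ∈ Ioo a b) (hd : HasDerivAt F d t)
    (hlim : ∀ τ ∈ Icc a b, Tendsto (fun n ↦ f n τ) atTop (𝓝 (F τ)))
    (hac : ∀ n, AbsolutelyContinuousOnInterval (f n) a b)
    (hae : ∀ n, ∀ᵐ τ : ℝ, τ ∈ Icc a b → ∃ w, HasDerivAt (f n) w τ ∧ R n τ w)
    (hR : ∀ η > 0, ∀ᶠ z : ℕ × ℝ in atTop ×ˢ 𝓝 t, ∀ w, R z.1 z.2 w → v - η ≤ w) : v ≤ d := by
  have := le_of_hasDerivAt_of_tendsto (f := fun n ↦ -f n) (F := -F)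
    (R := fun n τ w ↦ R n τ (-w)) (v := -v) ht hd.neg (fun τ hτ ↦ (hlim τ hτ).neg)
    (fun n ↦ (hac n).neg)
    (fun n ↦ by
      filter_upwards [hae n] with τ hτ hmem
      obtain ⟨w, hw, hRw⟩ := hτ hmem
      exact ⟨-w, hw.neg, by simpa using hRw⟩)
    (fun η hη ↦ by
      filter_upwards [hR η hη] with z hz w hw
      linarith [hz _ hw])
  linarith

/-! ### Second-order equations with dry friction -/

/-- The hypotheses on an equation `q̈ = A(q, t) - C(q, q̇, t) sgn q̇` with dry friction, where `A` is
the acceleration without friction and `C` the magnitude of the friction. The Lipschitz and growth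
conditions are only required locally uniformly in the time and in the velocity, so that `C` may be
quadratic in the velocity. -/
structure IsFrictionLaw (A : ℝ → ℝ → ℝ) (C : ℝ → ℝ → ℝ → ℝ) : Prop where
  continuous_drift : Continuous fun z : ℝ × ℝ ↦ A z.1 z.2
  continuous_friction : Continuous fun z : ℝ × ℝ × ℝ ↦ C z.1 z.2.1 z.2.2
  friction_nonneg : ∀ q p t, 0 ≤ C q p t
  bound : ∀ a b, ∃ M, 0 ≤ M ∧ ∀ t ∈ Icc a b, ∀ q, |A q t| ≤ M
  lipschitz : ∀ a b P, ∃ K, 0 ≤ K ∧ ∀ t ∈ Icc a b, ∀ q q' p p', |p| ≤ P → |p'| ≤ P →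
    |A q t - A q' t| ≤ K * |q - q'| ∧ |C q p t - C q' p' t| ≤ K * (|q - q'| + |p - p'|) ∧
      C q p t ≤ K

/-- `s` is an admissible value, up to an error `ε`, of the set-valued sign of `p`. For `ε = 0` this
says that `s` is the sign of `p` if `p ≠ 0`, and that `s ∈ [-1, 1]` if `p = 0`; for `ε > 0` it
admits `s = p / ε` for `|p| ≤ ε`. -/
structure IsSign (ε s p : ℝ) : Prop where
  abs_le_one : |s| ≤ 1
  mul_nonneg : 0 ≤ s * p
  sub_le_mul : |p| - ε ≤ s * p

theorem IsSign.eq_one {s p : ℝ} (h : IsSign 0 s p) (hp : 0 < p) : s = 1 := by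
  have h1 := h.sub_le_mul
  rw [abs_of_pos hp] at h1
  have h2 := (abs_le.1 h.abs_le_one).2
  nlinarith

theorem IsSign.eq_neg_one {s p : ℝ} (h : IsSign 0 s p) (hp : p < 0) : s = -1 := by
  have h1 := h.sub_le_mul
  rw [abs_of_neg hp] at h1
  have h2 := (abs_le.1 h.abs_le_one).1
  nlinarith

theorem exists_isSign_iff {α c p v : ℝ} (hc : 0 ≤ c) :
    (∃ s, IsSign 0 s p ∧ v = α - c * s) ↔
      α - c ≤ v ∧ v ≤ α + c ∧ (0 < p → v ≤ α - c) ∧ (p < 0 → α + c ≤ v) := by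
  constructor
  · rintro ⟨s, hs, rfl⟩
    obtain ⟨h1, h2⟩ := abs_le.1 hs.abs_le_one
    refine ⟨by nlinarith, by nlinarith, fun hp ↦ ?_, fun hp ↦ ?_⟩
    · rw [hs.eq_one hp]; linarith
    · rw [hs.eq_neg_one hp]; linarith
  · rintro ⟨h1, h2, h3, h4⟩
    rcases lt_trichotomy p 0 with hp | rfl | hp
    · exact ⟨-1, ⟨by simp, by linarith, by rw [abs_of_neg hp]; linarith⟩, by linarith [h4 hp]⟩
    · rcases hc.eq_or_lt with rfl | hc
      · exact ⟨0, ⟨by simp, by simp, by simp⟩, by linarith⟩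
      · refine ⟨(α - v) / c, ⟨?_, by simp, by simp⟩, by field_simp; ring⟩
        rw [abs_le, le_div_iff₀ hc, div_le_iff₀ hc]
        constructor <;> linarith
    · exact ⟨1, ⟨by simp, by linarith, by rw [abs_of_pos hp]; linarith⟩, by linarith [h3 hp]⟩

/-- `(q, p)` solves, on `[a, b]`, the equation with the acceleration `A` and the friction `C`, the
sign of `p` being taken up to an error `ε`. For `ε = 0` these are the solutions in the sense of
Filippov. -/
structure IsFrictionSolution (A : ℝ → ℝ → ℝ) (C : ℝ → ℝ → ℝ → ℝ) (ε a b : ℝ) (q p : ℝ → ℝ) :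
    Prop where
  ac_fst : AbsolutelyContinuousOnInterval q a b
  ac_snd : AbsolutelyContinuousOnInterval p a b
  ae_hasDerivAt : ∀ᵐ t : ℝ, t ∈ Icc a b → HasDerivAt q (p t) t ∧
    ∃ s, IsSign ε s (p t) ∧ HasDerivAt p (A (q t) t - C (q t) (p t) t * s) t

variable {A : ℝ → ℝ → ℝ} {C : ℝ → ℝ → ℝ → ℝ} {ε ε' a b : ℝ} {q p q' p' : ℝ → ℝ}

theorem IsFrictionSolution.mono {a' b' : ℝ} (h : IsFrictionSolution A C ε a b q p)
    (ha : a ≤ a') (hab : a' ≤ b') (hb : b' ≤ b) : IsFrictionSolution A C ε a' b' q p := by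
  have hsub : Icc a' b' ⊆ Icc a b := Icc_subset_Icc ha hb
  have hu : uIcc a' b' ⊆ uIcc a b := by
    rwa [uIcc_of_le hab, uIcc_of_le (ha.trans (hab.trans hb))]
  refine ⟨h.ac_fst.mono hu, h.ac_snd.mono hu, ?_⟩
  filter_upwards [h.ae_hasDerivAt] with t ht hmem using ht (hsub hmem)

theorem IsFrictionSolution.continuousOn_fst (h : IsFrictionSolution A C ε a b q p) (hab : a ≤ b) :
    ContinuousOn q (Icc a b) := uIcc_of_le hab ▸ h.ac_fst.continuousOn

/-! ### The velocity is bounded -/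

/-- If the kinetic energy `p² / 2` is produced at a rate of at most `M |p|`, then `p` is bounded. -/
theorem abs_le_of_ae_mul_hasDerivAt_le {M : ℝ} (hM : 0 ≤ M) (hab : a ≤ b)
    (hp : AbsolutelyContinuousOnInterval p a b)
    (h : ∀ᵐ t : ℝ, t ∈ Icc a b → ∃ w, HasDerivAt p w t ∧ p t * w ≤ M * |p t|) :
    |p b| ≤ Real.exp (M * (b - a)) * (p a ^ 2 + M * (b - a)) + 1 := by
  have key := (hp.fun_mul hp).le_exp_mul_of_ae_hasDerivAt_le hab hM hM (by
    filter_upwards [h] with t ht hmem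
    obtain ⟨w, hw, hle⟩ := ht hmem
    refine ⟨_, ?_, hw.mul hw⟩
    nlinarith [mul_nonneg hM (sq_nonneg (|p t| - 1)), sq_abs (p t)])
  rw [← sq, ← sq] at key
  nlinarith [sq_abs (p b), sq_nonneg (|p b| - 1)]

/-- Friction never accelerates: whatever its size, the velocity is bounded in terms of `A`. -/
theorem IsFrictionLaw.abs_velocity_le (hAC : IsFrictionLaw A C) (a b P₀ : ℝ) :
    ∃ P, ∀ ε q p, ∀ t ∈ Icc a b, IsFrictionSolution A C ε a t q p → |p a| ≤ P₀ → |p t| ≤ P := by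
  obtain ⟨M, hM0, hM⟩ := hAC.bound a b
  refine ⟨Real.exp (M * (b - a)) * (P₀ ^ 2 + M * (b - a)) + 1, fun ε q p t ht h hp ↦ ?_⟩
  refine (abs_le_of_ae_mul_hasDerivAt_le hM0 ht.1 h.ac_snd ?_).trans ?_
  · filter_upwards [h.ae_hasDerivAt] with τ hτ hmem
    obtain ⟨-, s, hs, hd⟩ := hτ hmem
    refine ⟨_, hd, ?_⟩
    have h1 : p τ * A (q τ) τ ≤ M * |p τ| := by
      rw [mul_comm M]
      refine (le_abs_self _).trans ?_
      rw [abs_mul]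
      exact mul_le_mul_of_nonneg_left (hM τ ⟨hmem.1, hmem.2.trans ht.2⟩ _) (abs_nonneg _)
    nlinarith [mul_nonneg (hAC.friction_nonneg (q τ) (p τ) τ) hs.mul_nonneg]
  · have h0 : 0 ≤ t - a := sub_nonneg.2 ht.1
    have h1 : t - a ≤ b - a := by linarith [ht.2]
    have h2 : p a ^ 2 ≤ P₀ ^ 2 := by rw [← sq_abs]; gcongr
    gcongr

/-! ### Comparison of solutions -/

/-- The sign is monotone, so the friction does not drive two solutions apart. Here
`x = q - q'`, and `α`, `α'` and `c`, `c'` are the values of `A` and `C` along the two solutions. -/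
theorem friction_comparison {K x p p' α α' c c' s s' : ℝ} (hs : IsSign ε s p) (hs' : IsSign ε' s' p')
    (hc : 0 ≤ c) (hcK : c ≤ K) (hε : 0 ≤ ε) (hε' : 0 ≤ ε') (hα : |α - α'| ≤ K * |x|)
    (hcc : |c - c'| ≤ K * (|x| + |p - p'|)) :
    2 * (x * (p - p')) + 2 * ((p - p') * ((α - c * s) - (α' - c' * s'))) ≤
      (1 + 4 * K) * (x ^ 2 + (p - p') ^ 2) + 2 * K * (ε + ε') := by
  have hK : 0 ≤ K := hc.trans hcK
  set y := p - p' with hy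
  have hmono : -(ε + ε') ≤ y * (s - s') := by
    have h1 := hs.sub_le_mul
    have h2 := hs'.sub_le_mul
    have h3 : s * p' ≤ |p'| := by
      refine (le_abs_self _).trans ?_
      rw [abs_mul]
      exact mul_le_of_le_one_left (abs_nonneg _) hs.abs_le_one
    have h4 : s' * p ≤ |p| := by
      refine (le_abs_self _).trans ?_
      rw [abs_mul]
      exact mul_le_of_le_one_left (abs_nonneg _) hs'.abs_le_one
    rw [hy]
    nlinarith
  have h1 : -(c * (y * (s - s'))) ≤ K * (ε + ε') := by
    have : c * -(ε + ε') ≤ c * (y * (s - s')) := mul_le_mul_of_nonneg_left hmono hc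
    have : c * (ε + ε') ≤ K * (ε + ε') := mul_le_mul_of_nonneg_right hcK (by linarith)
    linarith
  have h2 : y * (α - α') ≤ K * (|x| * |y|) := by
    refine (le_abs_self _).trans ?_
    rw [abs_mul]
    nlinarith [mul_le_mul_of_nonneg_left hα (abs_nonneg y)]
  have h3 : -(y * ((c - c') * s')) ≤ K * (|x| * |y| + |y| * |y|) := by
    refine (neg_le_abs _).trans ?_
    rw [abs_mul, abs_mul]
    have : |c - c'| * |s'| ≤ K * (|x| + |y|) :=
      (mul_le_of_le_one_right (abs_nonneg _) hs'.abs_le_one).trans hcc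
    nlinarith [mul_le_mul_of_nonneg_left this (abs_nonneg y)]
  have h4 : |x| * |y| ≤ (x ^ 2 + y ^ 2) / 2 := by
    nlinarith [sq_nonneg (|x| - |y|), sq_abs x, sq_abs y]
  have h5 : |y| * |y| = y ^ 2 := by rw [← sq, sq_abs]
  have h6 : x * y ≤ |x| * |y| := by rw [← abs_mul]; exact le_abs_self _
  have h7 := mul_le_mul_of_nonneg_left h4 hK
  have h8 : K * y ^ 2 ≤ K * (x ^ 2 + y ^ 2) :=
    mul_le_mul_of_nonneg_left (by linarith [sq_nonneg x]) hK
  rw [h5] at h3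
  linarith

/-- One-sided Lipschitz estimate: uniqueness, continuous dependence on the initial state and
convergence of approximate solutions all follow from it. -/
theorem IsFrictionLaw.comparison (hAC : IsFrictionLaw A C) (a b P₀ : ℝ) :
    ∃ L, 0 ≤ L ∧ ∀ ε ε' q p q' p', ∀ t ∈ Icc a b, 0 ≤ ε → 0 ≤ ε' →
      IsFrictionSolution A C ε a t q p → IsFrictionSolution A C ε' a t q' p' →
      |p a| ≤ P₀ → |p' a| ≤ P₀ →
      (q t - q' t) ^ 2 + (p t - p' t) ^ 2 ≤
        L * ((q a - q' a) ^ 2 + (p a - p' a) ^ 2 + (ε + ε')) := by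
  obtain ⟨P, hP⟩ := hAC.abs_velocity_le a b P₀
  obtain ⟨K, hK0, hK⟩ := hAC.lipschitz a b P
  rcases lt_or_ge b a with hba | hab
  · exact ⟨0, le_rfl, fun _ _ _ _ _ _ t ht ↦ absurd (ht.1.trans ht.2) hba.not_ge⟩
  refine ⟨Real.exp ((1 + 4 * K) * (b - a)) * (1 + 2 * K * (b - a)), ?_, ?_⟩
  · have := sub_nonneg.2 hab
    positivity
  intro ε ε' q p q' p' t ht hε hε' h h' hp hp'
  have hx := h.ac_fst.fun_sub h'.ac_fst
  have hy := h.ac_snd.fun_sub h'.ac_snd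
  have key := ((hx.fun_mul hx).fun_add (hy.fun_mul hy)).le_exp_mul_of_ae_hasDerivAt_le
    (K := 1 + 4 * K) (c := 2 * K * (ε + ε')) ht.1 (by positivity) (by positivity) (by
      filter_upwards [h.ae_hasDerivAt, h'.ae_hasDerivAt] with τ hτ hτ' hmem
      obtain ⟨hq, s, hs, hd⟩ := hτ hmem
      obtain ⟨hq', s', hs', hd'⟩ := hτ' hmem
      have hτb : τ ∈ Icc a b := ⟨hmem.1, hmem.2.trans ht.2⟩
      have hpP := hP ε q p τ hτb (h.mono le_rfl hmem.1 hmem.2) hp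
      have hpP' := hP ε' q' p' τ hτb (h'.mono le_rfl hmem.1 hmem.2) hp'
      obtain ⟨k1, k2, k3⟩ := hK τ hτb (q τ) (q' τ) (p τ) (p' τ) hpP hpP'
      have := friction_comparison hs hs' (hAC.friction_nonneg _ _ _) k3 hε hε' k1 k2
      refine ⟨_, ?_, ((hq.sub hq').mul (hq.sub hq')).add ((hd.sub hd').mul (hd.sub hd'))⟩
      simp only [Pi.sub_apply]
      linarith)
  have e1 : Real.exp ((1 + 4 * K) * (t - a)) ≤ Real.exp ((1 + 4 * K) * (b - a)) := by
    gcongr; exact ht.2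
  have e2 : 2 * K * (ε + ε') * (t - a) ≤ 2 * K * (b - a) * (ε + ε') := by
    rw [mul_right_comm]; gcongr; exact ht.2
  set D := (q a - q' a) ^ 2 + (p a - p' a) ^ 2 with hD
  have hD0 : 0 ≤ D := by positivity
  have hba := sub_nonneg.2 hab
  have hta := sub_nonneg.2 ht.1
  calc (q t - q' t) ^ 2 + (p t - p' t) ^ 2
      ≤ Real.exp ((1 + 4 * K) * (t - a)) * (D + 2 * K * (ε + ε') * (t - a)) := by
        simpa only [sq, hD] using key
    _ ≤ Real.exp ((1 + 4 * K) * (b - a)) * ((1 + 2 * K * (b - a)) * (D + (ε + ε'))) := by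
        refine mul_le_mul e1 ?_ (by positivity) (by positivity)
        have : 0 ≤ 2 * K * (b - a) * D := by positivity
        nlinarith
    _ = _ := by ring

theorem IsFrictionLaw.eqOn_of_initial_eq (hAC : IsFrictionLaw A C) (hab : a ≤ b)
    (h : IsFrictionSolution A C 0 a b q p) (h' : IsFrictionSolution A C 0 a b q' p')
    (hq : q a = q' a) (hp : p a = p' a) : q b = q' b ∧ p b = p' b := by
  obtain ⟨L, -, hL⟩ := hAC.comparison a b |p a|
  have := hL 0 0 q p q' p' b ⟨hab, le_rfl⟩ le_rfl le_rfl h h' le_rfl (by rw [hp])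
  simp only [hq, hp, sub_self, add_zero, ne_eq, OfNat.ofNat_ne_zero, not_false_eq_true, zero_pow,
    mul_zero] at this
  constructor <;> nlinarith [sq_nonneg (q b - q' b), sq_nonneg (p b - p' b)]

/-! ### Solutions of the regularized equation -/

/-- The truncation of `x` to `[-r, r]`. -/
noncomputable def clip (r x : ℝ) : ℝ := max (-r) (min r x)

theorem continuous_clip (r : ℝ) : Continuous (clip r) := by
  unfold clip; fun_prop

theorem abs_clip_le {r : ℝ} (hr : 0 ≤ r) (x : ℝ) : |clip r x| ≤ r := by
  rw [abs_le, clip]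
  exact ⟨le_max_left _ _, max_le (by linarith) (min_le_left _ _)⟩

theorem clip_eq_self {r x : ℝ} (h : |x| ≤ r) : clip r x = x := by
  rw [abs_le] at h
  rw [clip, min_eq_right h.2, max_eq_right h.1]

theorem abs_clip_sub_clip_le (r x y : ℝ) : |clip r x - clip r y| ≤ |x - y| :=
  (abs_max_sub_max_le_max _ _ _ _).trans
    (max_le (by simp) ((abs_min_sub_min_le_max _ _ _ _).trans (max_le (by simp) le_rfl)))

theorem isSign_clip (hε : 0 < ε) (p : ℝ) : IsSign ε (clip 1 (p / ε)) p := by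
  rcases le_or_gt |p / ε| 1 with h | h
  · rw [clip_eq_self h]
    have h1 : 0 ≤ p / ε * p := by
      rw [div_mul_eq_mul_div]; exact div_nonneg (mul_self_nonneg p) hε.le
    refine ⟨h, h1, ?_⟩
    rw [abs_div, abs_of_pos hε, div_le_one hε] at h
    linarith
  · have : clip 1 (p / ε) * p = |p| := by
      rcases lt_abs.1 h with h | h
      · have hp : 0 < p := by
          rw [lt_div_iff₀ hε] at h; linarith
        rw [clip, min_eq_left h.le, max_eq_right (by norm_num), one_mul, abs_of_pos hp]
      · have hp : p < 0 := by
          rw [← neg_div, lt_div_iff₀ hε] at h; linarith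
        rw [clip, min_eq_right (by linarith), max_eq_left (by linarith), abs_of_neg hp]
        ring
    exact ⟨abs_clip_le zero_le_one _, this ▸ abs_nonneg _, by linarith⟩

/-- The equation becomes Lipschitz when the sign of `p` is replaced by `clip 1 (p / ε)`, and the
friction at `p` by the friction at `clip R p`. The a priori bound on the velocity shows that for
large `R` the second change does not affect the solution. -/
theorem IsFrictionLaw.exists_approx (hAC : IsFrictionLaw A C) (hab : a ≤ b) (hε : 0 < ε)
    (q₀ p₀ : ℝ) :
    ∃ q p : ℝ → ℝ, q a = q₀ ∧ p a = p₀ ∧ IsFrictionSolution A C ε a b q p := by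
  obtain ⟨M, hM0, hM⟩ := hAC.bound a b
  have hba : 0 ≤ b - a := sub_nonneg.2 hab
  set R : ℝ := Real.exp (M * (b - a)) * (p₀ ^ 2 + M * (b - a)) + 1 with hR
  have hR0 : 0 ≤ R := by positivity
  obtain ⟨K, hK0, hK⟩ := hAC.lipschitz a b R
  let v : ℝ → ℝ × ℝ → ℝ × ℝ := fun t z ↦
    (clip R z.2, A z.1 t - C z.1 (clip R z.2) t * clip 1 (z.2 / ε))
  have hclip : ∀ x, |clip R x| ≤ R := abs_clip_le hR0
  have hclip1 : ∀ x, |clip 1 x| ≤ 1 := abs_clip_le zero_le_one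
  have hv_bound : ∀ t ∈ Icc a b, ∀ z, ‖v t z‖ ≤ R + M + K := by
    intro t ht z
    have h1 : |C z.1 (clip R z.2) t * clip 1 (z.2 / ε)| ≤ K := by
      rw [abs_mul, abs_of_nonneg (hAC.friction_nonneg _ _ _)]
      exact (mul_le_of_le_one_right (hAC.friction_nonneg _ _ _) (hclip1 _)).trans
        (hK t ht z.1 z.1 _ _ (hclip z.2) (hclip z.2)).2.2
    refine max_le ?_ ?_
    · exact (hclip z.2).trans (by linarith)
    · exact (abs_sub _ _).trans (by linarith [hM t ht z.1])
  have hv_lip : ∀ t ∈ Icc a b, ∀ z z', ‖v t z - v t z'‖ ≤ (1 + 3 * K + K / ε) * ‖z - z'‖ := by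
    intro t ht z z'
    have hz1 : |z.1 - z'.1| ≤ ‖z - z'‖ := norm_fst_le (z - z')
    have hz2 : |z.2 - z'.2| ≤ ‖z - z'‖ := norm_snd_le (z - z')
    set n := ‖z - z'‖
    have hn : 0 ≤ n := norm_nonneg _
    obtain ⟨k1, k2, -⟩ := hK t ht z.1 z'.1 _ _ (hclip z.2) (hclip z'.2)
    have k3 := (hK t ht z'.1 z'.1 _ _ (hclip z'.2) (hclip z'.2)).2.2
    have hKε : 0 ≤ K / ε := by positivity
    have hc2 := (abs_clip_sub_clip_le R z.2 z'.2).trans hz2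
    refine max_le ?_ ?_
    · refine hc2.trans ?_
      nlinarith [mul_nonneg hK0 hn, mul_nonneg hKε hn]
    · set c := C z.1 (clip R z.2) t
      set c' := C z'.1 (clip R z'.2) t
      set s := clip 1 (z.2 / ε)
      set s' := clip 1 (z'.2 / ε)
      have hs : |s - s'| ≤ n / ε := by
        refine (abs_clip_sub_clip_le _ _ _).trans ?_
        rw [← sub_div, abs_div, abs_of_pos hε]
        gcongr
      have e1 : |(c - c') * s| ≤ 2 * K * n := by
        rw [abs_mul]
        refine (mul_le_of_le_one_right (abs_nonneg _) (hclip1 _)).trans (k2.trans ?_)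
        nlinarith
      have e2 : |c' * (s - s')| ≤ K / ε * n := by
        rw [abs_mul, abs_of_nonneg (hAC.friction_nonneg _ _ _)]
        calc c' * |s - s'| ≤ K * (n / ε) :=
              mul_le_mul k3 hs (abs_nonneg _) hK0
          _ = K / ε * n := by ring
      have e3 : |A z.1 t - A z'.1 t| ≤ K * n := k1.trans (mul_le_mul_of_nonneg_left hz1 hK0)
      have e4 : (A z.1 t - c * s) - (A z'.1 t - c' * s') =
          (A z.1 t - A z'.1 t) - (c - c') * s - c' * (s - s') := by ring
      change |(A z.1 t - c * s) - (A z'.1 t - c' * s')| ≤ _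
      rw [e4]
      refine (abs_sub _ _).trans ?_
      have := abs_sub (A z.1 t - A z'.1 t) ((c - c') * s)
      nlinarith
  have hv_cont : Continuous fun y : ℝ × ℝ × ℝ ↦ v y.1 y.2 := by
    have h1 := continuous_clip R
    have h2 := continuous_clip 1
    have hA := hAC.continuous_drift
    have hC := hAC.continuous_friction
    refine (h1.comp (by fun_prop)).prodMk (Continuous.sub ?_ (Continuous.mul ?_ ?_))
    · exact hA.comp (f := fun y : ℝ × ℝ × ℝ ↦ (y.2.1, y.1)) (by fun_prop)
    · exact hC.comp (f := fun y : ℝ × ℝ × ℝ ↦ (y.2.1, clip R y.2.2, y.1)) (by fun_prop)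
    · exact h2.comp (by fun_prop)
  have hL0 : 0 ≤ R + M + K := by positivity
  have hPL : IsPicardLindelof v (⟨a, le_rfl, hab⟩ : Icc a b) (q₀, p₀)
      (⟨(R + M + K) * (b - a), by positivity⟩) 0 ⟨R + M + K, hL0⟩
      ⟨1 + 3 * K + K / ε, by positivity⟩ := by
    refine ⟨fun t ht ↦ ?_, fun z _ ↦ ?_, fun t ht z _ ↦ hv_bound t ht z, ?_⟩
    · exact (LipschitzWith.of_dist_le_mul fun z z' ↦ by
        rw [dist_eq_norm, dist_eq_norm]; exact hv_lip t ht z z').lipschitzOnWith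
    · exact (hv_cont.comp (f := fun t : ℝ ↦ (t, z)) (by fun_prop)).continuousOn
    · simp only [sub_self, NNReal.coe_zero, sub_zero, max_eq_left hba]
      exact le_rfl
  obtain ⟨α, hα0, hα⟩ := hPL.exists_eq_forall_mem_Icc_hasDerivWithinAt₀
  have hα_ac : AbsolutelyContinuousOnInterval α a b := by
    refine LipschitzOnWith.absolutelyContinuousOnInterval (K := ⟨R + M + K, hL0⟩) ?_
    rw [uIcc_of_le hab]
    exact (convex_Icc a b).lipschitzOnWith_of_nnnorm_hasDerivWithin_le hα
      fun t ht ↦ hv_bound t ht _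
  have hα' : ∀ t ∈ Ioo a b, HasDerivAt (fun t ↦ (α t).1) (clip R (α t).2) t ∧
      HasDerivAt (fun t ↦ (α t).2)
        (A (α t).1 t - C (α t).1 (clip R (α t).2) t * clip 1 ((α t).2 / ε)) t := by
    intro t ht
    have h := (hα t (Ioo_subset_Icc_self ht)).hasDerivAt (Icc_mem_nhds ht.1 ht.2)
    exact ⟨h.fst, h.snd⟩
  have hIoo : ∀ᵐ t : ℝ, t ∈ Icc a b → t ∈ Ioo a b := by
    have h1 : ∀ᵐ t : ℝ, t ≠ a := by simp [ae_iff, measure_singleton]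
    have h2 : ∀ᵐ t : ℝ, t ≠ b := by simp [ae_iff, measure_singleton]
    filter_upwards [h1, h2] with t h1 h2 ht
    exact ⟨ht.1.lt_of_ne h1.symm, ht.2.lt_of_ne h2⟩
  -- the bound does not involve the friction, so it holds although the friction is truncated
  have hspeed : ∀ t ∈ Icc a b, |(α t).2| ≤ R := by
    intro t ht
    refine (abs_le_of_ae_mul_hasDerivAt_le hM0 ht.1 (hα_ac.snd.mono ?_) ?_).trans ?_
    · rw [uIcc_of_le ht.1, uIcc_of_le hab]
      exact Icc_subset_Icc_right ht.2
    · filter_upwards [hIoo] with τ hτ hmem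
      have hτb : τ ∈ Icc a b := ⟨hmem.1, hmem.2.trans ht.2⟩
      refine ⟨_, (hα' τ (hτ hτb)).2, ?_⟩
      have h1 : (α τ).2 * A (α τ).1 τ ≤ M * |(α τ).2| := by
        rw [mul_comm M]
        refine (le_abs_self _).trans ?_
        rw [abs_mul]
        exact mul_le_mul_of_nonneg_left (hM τ hτb _) (abs_nonneg _)
      nlinarith [mul_nonneg (hAC.friction_nonneg (α τ).1 (clip R (α τ).2) τ)
        (isSign_clip hε (α τ).2).mul_nonneg]
    · have h0 : 0 ≤ t - a := sub_nonneg.2 ht.1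
      have h1 : t - a ≤ b - a := by linarith [ht.2]
      have h2 : (α a).2 = p₀ := congrArg Prod.snd hα0
      rw [h2, hR]
      gcongr
  refine ⟨fun t ↦ (α t).1, fun t ↦ (α t).2, congrArg Prod.fst hα0, congrArg Prod.snd hα0,
    hα_ac.fst, hα_ac.snd, ?_⟩
  filter_upwards [hIoo] with t ht hmem
  obtain ⟨h1, h2⟩ := hα' t (ht hmem)
  rw [clip_eq_self (hspeed t hmem)] at h1 h2
  exact ⟨h1, _, isSign_clip hε _, h2⟩

/-! ### Limits of approximate solutions -/

theorem AbsolutelyContinuousOnInterval.abs_sub_le_of_ae_hasDerivAt {f : ℝ → ℝ} {a b L : ℝ}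
    (hab : a ≤ b) (hf : AbsolutelyContinuousOnInterval f a b)
    (h : ∀ᵐ t : ℝ, t ∈ Icc a b → ∃ w, |w| ≤ L ∧ HasDerivAt f w t) {s t : ℝ} (hs : s ∈ Icc a b)
    (ht : t ∈ Icc a b) : |f s - f t| ≤ L * |s - t| := by
  wlog hst : s ≤ t generalizing s t
  · rw [abs_sub_comm, abs_sub_comm s]
    exact this ht hs (le_of_not_ge hst)
  have hsub : Icc s t ⊆ Icc a b := Icc_subset_Icc hs.1 ht.2
  have hf' : AbsolutelyContinuousOnInterval f s t :=
    hf.mono (by rwa [uIcc_of_le hst, uIcc_of_le hab])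
  have h1 := hf'.sub_le_of_ae_hasDerivAt_le (v := L) hst (by
    filter_upwards [h] with τ hτ hmem
    obtain ⟨w, hw, hd⟩ := hτ (hsub hmem)
    exact ⟨w, (le_abs_self w).trans hw, hd⟩)
  have h2 := hf'.neg.sub_le_of_ae_hasDerivAt_le (v := L) hst (by
    filter_upwards [h] with τ hτ hmem
    obtain ⟨w, hw, hd⟩ := hτ (hsub hmem)
    exact ⟨-w, (neg_le_abs w).trans hw, hd.neg⟩)
  simp only [Pi.neg_apply] at h2
  rw [abs_sub_comm s t, abs_of_nonneg (sub_nonneg.2 hst), abs_le]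
  constructor <;> linarith

/-- A family of friction solutions with bounded initial velocities is equi-Lipschitz. -/
theorem IsFrictionLaw.lipschitz_solution (hAC : IsFrictionLaw A C) (hab : a ≤ b) (P₀ : ℝ) :
    ∃ L, 0 ≤ L ∧ ∀ ε q p, IsFrictionSolution A C ε a b q p → |p a| ≤ P₀ →
      ∀ s ∈ Icc a b, ∀ t ∈ Icc a b, |q s - q t| ≤ L * |s - t| ∧ |p s - p t| ≤ L * |s - t| := by
  obtain ⟨P, hP⟩ := hAC.abs_velocity_le a b P₀
  obtain ⟨K, hK0, hK⟩ := hAC.lipschitz a b P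
  obtain ⟨M, hM0, hM⟩ := hAC.bound a b
  refine ⟨max P (M + K), le_max_of_le_right (by positivity), fun ε q p h hp s hs t ht ↦ ?_⟩
  have hbound : ∀ τ ∈ Icc a b, |p τ| ≤ P :=
    fun τ hτ ↦ hP ε q p τ hτ (h.mono le_rfl hτ.1 hτ.2) hp
  constructor
  · refine h.ac_fst.abs_sub_le_of_ae_hasDerivAt hab ?_ hs ht
    filter_upwards [h.ae_hasDerivAt] with τ hτ hmem
    exact ⟨_, (hbound τ hmem).trans (le_max_left _ _), (hτ hmem).1⟩
  · refine h.ac_snd.abs_sub_le_of_ae_hasDerivAt hab ?_ hs ht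
    filter_upwards [h.ae_hasDerivAt] with τ hτ hmem
    obtain ⟨-, σ, hσ, hd⟩ := hτ hmem
    refine ⟨_, le_max_of_le_right ?_, hd⟩
    refine (abs_sub _ _).trans (add_le_add (hM τ hmem _) ?_)
    rw [abs_mul, abs_of_nonneg (hAC.friction_nonneg _ _ _)]
    exact (mul_le_of_le_one_right (hAC.friction_nonneg _ _ _) hσ.abs_le_one).trans
      (hK τ hmem (q τ) (q τ) _ _ (hbound τ hmem) (hbound τ hmem)).2.2

/-- For equi-Lipschitz functions, pointwise convergence is convergence jointly in `n` and `τ`. -/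
theorem tendsto_prod_of_abs_sub_le {f : ℕ → ℝ → ℝ} {F : ℝ → ℝ} {L t : ℝ} (ht : t ∈ Ioo a b)
    (hL : ∀ n, ∀ τ ∈ Icc a b, |f n τ - f n t| ≤ L * |τ - t|)
    (hlim : Tendsto (fun n ↦ f n t) atTop (𝓝 (F t))) :
    Tendsto (fun z : ℕ × ℝ ↦ f z.1 z.2) (atTop ×ˢ 𝓝 t) (𝓝 (F t)) := by
  have h1 : Tendsto (fun z : ℕ × ℝ ↦ f z.1 t) (atTop ×ˢ 𝓝 t) (𝓝 (F t)) :=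
    hlim.comp tendsto_fst
  have h2 : Tendsto (fun z : ℕ × ℝ ↦ L * |z.2 - t|) (atTop ×ˢ 𝓝 t) (𝓝 0) := by
    have : Tendsto (fun τ : ℝ ↦ L * |τ - t|) (𝓝 t) (𝓝 (L * |t - t|)) :=
      Continuous.tendsto (by fun_prop) t
    rw [sub_self, abs_zero, mul_zero] at this
    exact this.comp tendsto_snd
  have h3 : Tendsto (fun z : ℕ × ℝ ↦ f z.1 z.2 - f z.1 t) (atTop ×ˢ 𝓝 t) (𝓝 0) := by
    refine squeeze_zero_norm' ?_ h2
    filter_upwards [tendsto_snd.eventually (Icc_mem_nhds ht.1 ht.2)] with z hz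
    exact hL _ _ hz
  simpa using h3.add h1

/-- The pointwise limit of approximate solutions whose errors tend to `0` is a solution. Where
`p ≠ 0` the sign is eventually exact; where `p = 0` only `|s| ≤ 1` survives in the limit. -/
theorem IsFrictionLaw.solution_of_tendsto (hAC : IsFrictionLaw A C) (hab : a ≤ b) {P₀ : ℝ}
    {ε : ℕ → ℝ} {f g : ℕ → ℝ → ℝ} (hε : Tendsto ε atTop (𝓝 0))
    (h : ∀ n, IsFrictionSolution A C (ε n) a b (f n) (g n)) (hg₀ : ∀ n, |g n a| ≤ P₀)
    (hq : ∀ t ∈ Icc a b, Tendsto (fun n ↦ f n t) atTop (𝓝 (q t)))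
    (hp : ∀ t ∈ Icc a b, Tendsto (fun n ↦ g n t) atTop (𝓝 (p t))) :
    IsFrictionSolution A C 0 a b q p := by
  obtain ⟨L, hL0, hL⟩ := hAC.lipschitz_solution hab P₀
  have hL' := fun n ↦ hL (ε n) (f n) (g n) (h n) (hg₀ n)
  have hac : ∀ (u : ℝ → ℝ) (w : ℕ → ℝ → ℝ),
      (∀ t ∈ Icc a b, Tendsto (fun n ↦ w n t) atTop (𝓝 (u t))) →
      (∀ n, ∀ s ∈ Icc a b, ∀ t ∈ Icc a b, |w n s - w n t| ≤ L * |s - t|) →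
      AbsolutelyContinuousOnInterval u a b := by
    intro u w hlim hw
    refine LipschitzOnWith.absolutelyContinuousOnInterval (K := ⟨L, hL0⟩) ?_
    rw [uIcc_of_le hab]
    refine LipschitzOnWith.of_dist_le_mul fun s hs t ht ↦ ?_
    exact le_of_tendsto ((hlim s hs).sub (hlim t ht)).abs (.of_forall fun n ↦ hw n s hs t ht)
  have hqac := hac q f hq fun n s hs t ht ↦ (hL' n s hs t ht).1
  have hpac := hac p g hp fun n s hs t ht ↦ (hL' n s hs t ht).2
  refine ⟨hqac, hpac, ?_⟩
  have h1 : ∀ᵐ t : ℝ, t ≠ a := by simp [ae_iff, measure_singleton]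
  have h2 : ∀ᵐ t : ℝ, t ≠ b := by simp [ae_iff, measure_singleton]
  filter_upwards [hqac.ae_differentiableAt, hpac.ae_differentiableAt, h1, h2] with t hdq hdp h1 h2 ht
  have htI : t ∈ Ioo a b := ⟨ht.1.lt_of_ne h1.symm, ht.2.lt_of_ne h2⟩
  rw [uIcc_of_le hab] at hdq hdp
  have hdq := (hdq ht).hasDerivAt
  have hdp := (hdp ht).hasDerivAt
  have hfT : Tendsto (fun z : ℕ × ℝ ↦ f z.1 z.2) (atTop ×ˢ 𝓝 t) (𝓝 (q t)) :=
    tendsto_prod_of_abs_sub_le htI (fun n τ hτ ↦ (hL' n τ hτ t ht).1) (hq t ht)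
  have hgT : Tendsto (fun z : ℕ × ℝ ↦ g z.1 z.2) (atTop ×ˢ 𝓝 t) (𝓝 (p t)) :=
    tendsto_prod_of_abs_sub_le htI (fun n τ hτ ↦ (hL' n τ hτ t ht).2) (hp t ht)
  have hεT : Tendsto (fun z : ℕ × ℝ ↦ ε z.1) (atTop ×ˢ 𝓝 t) (𝓝 0) := hε.comp tendsto_fst
  have hτT : Tendsto (fun z : ℕ × ℝ ↦ z.2) (atTop ×ˢ 𝓝 t) (𝓝 t) := tendsto_snd
  have hAT : Tendsto (fun z : ℕ × ℝ ↦ A (f z.1 z.2) z.2) (atTop ×ˢ 𝓝 t) (𝓝 (A (q t) t)) :=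
    (hAC.continuous_drift.tendsto (q t, t)).comp (hfT.prodMk_nhds hτT)
  have hCT : Tendsto (fun z : ℕ × ℝ ↦ C (f z.1 z.2) (g z.1 z.2) z.2) (atTop ×ˢ 𝓝 t)
      (𝓝 (C (q t) (p t) t)) :=
    (hAC.continuous_friction.tendsto (q t, p t, t)).comp (hfT.prodMk_nhds (hgT.prodMk_nhds hτT))
  have hC0 := hAC.friction_nonneg
  have hqae : ∀ n, ∀ᵐ τ : ℝ, τ ∈ Icc a b → ∃ w, HasDerivAt (f n) w τ ∧ w = g n τ := by
    intro n
    filter_upwards [(h n).ae_hasDerivAt] with τ hτ hmem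
    exact ⟨_, (hτ hmem).1, rfl⟩
  have hpae : ∀ n, ∀ᵐ τ : ℝ, τ ∈ Icc a b → ∃ w, HasDerivAt (g n) w τ ∧
      ∃ s, IsSign (ε n) s (g n τ) ∧ w = A (f n τ) τ - C (f n τ) (g n τ) τ * s := by
    intro n
    filter_upwards [(h n).ae_hasDerivAt] with τ hτ hmem
    obtain ⟨-, s, hs, hd⟩ := hτ hmem
    exact ⟨_, hd, s, hs, rfl⟩
  have hupper := fun v ↦
    le_of_hasDerivAt_of_tendsto (v := v) htI hdp hp (fun n ↦ (h n).ac_snd) hpae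
  have hlower := fun v ↦
    ge_of_hasDerivAt_of_tendsto (v := v) htI hdp hp (fun n ↦ (h n).ac_snd) hpae
  constructor
  · have : deriv q t = p t := by
      apply le_antisymm
      · refine le_of_hasDerivAt_of_tendsto htI hdq hq (fun n ↦ (h n).ac_fst) hqae fun η hη ↦ ?_
        filter_upwards [hgT.eventually_le_const (lt_add_of_pos_right _ hη)] with z hz w hw
        exact hw.trans_le hz
      · refine ge_of_hasDerivAt_of_tendsto htI hdq hq (fun n ↦ (h n).ac_fst) hqae fun η hη ↦ ?_
        filter_upwards [hgT.eventually_const_le (sub_lt_self _ hη)] with z hz w hw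
        exact hz.trans_eq hw.symm
    rwa [this] at hdq
  have hsign : ∃ s, IsSign 0 s (p t) ∧ deriv p t = A (q t) t - C (q t) (p t) t * s := by
    rw [exists_isSign_iff (hC0 _ _ _)]
    refine ⟨hlower _ fun η hη ↦ ?_, hupper _ fun η hη ↦ ?_, fun hpt ↦ hupper _ fun η hη ↦ ?_,
      fun hpt ↦ hlower _ fun η hη ↦ ?_⟩
    · filter_upwards [(hAT.sub hCT).eventually_const_le (sub_lt_self _ hη)] with z hz w hw
      obtain ⟨s, hs, rfl⟩ := hw
      nlinarith [hC0 (f z.1 z.2) (g z.1 z.2) z.2, (abs_le.1 hs.abs_le_one).2]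
    · filter_upwards [(hAT.add hCT).eventually_le_const (lt_add_of_pos_right _ hη)] with z hz w hw
      obtain ⟨s, hs, rfl⟩ := hw
      nlinarith [hC0 (f z.1 z.2) (g z.1 z.2) z.2, (abs_le.1 hs.abs_le_one).1]
    · have hT := hAT.sub (hCT.mul ((tendsto_const_nhds (x := (1 : ℝ))).sub (hεT.div hgT hpt.ne')))
      rw [zero_div, sub_zero, mul_one] at hT
      filter_upwards [hT.eventually_le_const (lt_add_of_pos_right _ hη),
        hgT.eventually_const_lt hpt] with z hz hpz w hw
      simp only [Pi.div_apply] at hz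
      obtain ⟨s, hs, rfl⟩ := hw
      have h4 : 1 - ε z.1 / g z.1 z.2 ≤ s := by
        have := hs.sub_le_mul
        rw [abs_of_pos hpz] at this
        rw [one_sub_div hpz.ne', div_le_iff₀ hpz]
        exact this
      have := mul_le_mul_of_nonneg_left h4 (hC0 (f z.1 z.2) (g z.1 z.2) z.2)
      linarith
    · have hT := hAT.add (hCT.mul ((tendsto_const_nhds (x := (1 : ℝ))).add (hεT.div hgT hpt.ne)))
      rw [zero_div, add_zero, mul_one] at hT
      filter_upwards [hT.eventually_const_le (sub_lt_self _ hη),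
        hgT.eventually_lt_const hpt] with z hz hpz w hw
      simp only [Pi.div_apply] at hz
      obtain ⟨s, hs, rfl⟩ := hw
      have h4 : 1 + ε z.1 / g z.1 z.2 ≤ -s := by
        have := hs.sub_le_mul
        rw [abs_of_neg hpz] at this
        rw [one_add_div hpz.ne, div_le_iff_of_neg hpz]
        linarith
      have := mul_le_mul_of_nonneg_left h4 (hC0 (f z.1 z.2) (g z.1 z.2) z.2)
      linarith
  obtain ⟨s, hs, hds⟩ := hsign
  exact ⟨s, hs, hds ▸ hdp⟩

/-- Solutions exist for all future times, for every initial state. -/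
theorem IsFrictionLaw.exists_solution (hAC : IsFrictionLaw A C) (a q₀ p₀ : ℝ) :
    ∃ q p : ℝ → ℝ, q a = q₀ ∧ p a = p₀ ∧ ∀ b ≥ a, IsFrictionSolution A C 0 a b q p := by
  have hpos : ∀ n : ℕ, 0 < 1 / ((n : ℝ) + 1) := fun n ↦ by positivity
  have hε : Tendsto (fun n : ℕ ↦ 1 / ((n : ℝ) + 1)) atTop (𝓝 0) :=
    tendsto_one_div_add_atTop_nhds_zero_nat
  choose f g hf0 hg0 hfg using fun n : ℕ ↦
    hAC.exists_approx (le_add_of_nonneg_right n.cast_nonneg : a ≤ a + n) (hpos n) q₀ p₀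
  have hcauchy : ∀ t ≥ a, CauchySeq (fun n ↦ f n t) ∧ CauchySeq (fun n ↦ g n t) := by
    intro t ht
    obtain ⟨L, hL0, hL⟩ := hAC.comparison a t |p₀|
    obtain ⟨N, hN⟩ := exists_nat_ge (t - a)
    have hdist : ∀ δ > 0, ∃ N', ∀ m ≥ N', ∀ n ≥ N',
        (f m t - f n t) ^ 2 + (g m t - g n t) ^ 2 < δ ^ 2 := by
      intro δ hδ
      have hlim : Tendsto (fun n : ℕ ↦ L * (1 / ((n : ℝ) + 1))) atTop (𝓝 0) := by
        simpa using hε.const_mul L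
      obtain ⟨N', hN'⟩ := eventually_atTop.1
        (hlim.eventually_lt_const (by positivity : 0 < δ ^ 2 / 2))
      refine ⟨max N N', fun m hm n hn ↦ ?_⟩
      have hsol : ∀ k ≥ max N N', IsFrictionSolution A C (1 / ((k : ℝ) + 1)) a t (f k) (g k) := by
        intro k hk
        refine (hfg k).mono le_rfl ht ?_
        have : (N : ℝ) ≤ k := by exact_mod_cast (le_max_left _ _).trans hk
        linarith
      have h1 := hL _ _ _ _ _ _ t ⟨ht, le_rfl⟩ (hpos m).le (hpos n).le (hsol m hm) (hsol n hn)
        (by rw [hg0]) (by rw [hg0])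
      rw [hf0, hf0, hg0, hg0, sub_self, sub_self] at h1
      have h2 := hN' m ((le_max_right _ _).trans hm)
      have h3 := hN' n ((le_max_right _ _).trans hn)
      nlinarith
    constructor <;>
    · refine Metric.cauchySeq_iff.2 fun δ hδ ↦ ?_
      obtain ⟨N', hN'⟩ := hdist δ hδ
      refine ⟨N', fun m hm n hn ↦ ?_⟩
      have := hN' m hm n hn
      rw [Real.dist_eq]
      refine abs_lt_of_sq_lt_sq ?_ hδ.le
      nlinarith [sq_nonneg (f m t - f n t), sq_nonneg (g m t - g n t)]
  -- the approximate solutions are controlled only after the initial time; before it, any value does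
  have hexq : ∀ t, ∃ y, t ≥ a → Tendsto (fun n ↦ f n t) atTop (𝓝 y) := fun t ↦ by
    by_cases ht : t ≥ a
    · obtain ⟨y, hy⟩ := cauchySeq_tendsto_of_complete (hcauchy t ht).1
      exact ⟨y, fun _ ↦ hy⟩
    · exact ⟨0, fun h ↦ absurd h ht⟩
  have hexp : ∀ t, ∃ y, t ≥ a → Tendsto (fun n ↦ g n t) atTop (𝓝 y) := fun t ↦ by
    by_cases ht : t ≥ a
    · obtain ⟨y, hy⟩ := cauchySeq_tendsto_of_complete (hcauchy t ht).2
      exact ⟨y, fun _ ↦ hy⟩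
    · exact ⟨0, fun h ↦ absurd h ht⟩
  choose q hq using hexq
  choose p hp using hexp
  refine ⟨q, p, ?_, ?_, fun b hb ↦ ?_⟩
  · exact tendsto_nhds_unique (hq a le_rfl) (by simp [hf0])
  · exact tendsto_nhds_unique (hp a le_rfl) (by simp [hg0])
  · obtain ⟨N, hN⟩ := exists_nat_ge (b - a)
    refine hAC.solution_of_tendsto (P₀ := |p₀|) (ε := fun n ↦ 1 / (((n + N : ℕ) : ℝ) + 1))
      (f := fun n ↦ f (n + N)) (g := fun n ↦ g (n + N)) hb
      (hε.comp (tendsto_add_atTop_nat N)) (fun n ↦ (hfg (n + N)).mono le_rfl hb ?_)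
      (fun n ↦ by rw [hg0])
      (fun t ht ↦ (hq t ht.1).comp (tendsto_add_atTop_nat N))
      (fun t ht ↦ (hp t ht.1).comp (tendsto_add_atTop_nat N))
    push_cast
    linarith [n.cast_nonneg (α := ℝ)]

/-! ### Trajectories between two repelling levels -/

/-- Suppose that `u ≥ 0` moves with velocity `v`, starting with `v ≤ 0`, and that a positive
velocity decreases near `u = 0`. Then `u`, having reached `0`, cannot become positive again: the
velocity is not positive at the last zero of `u`, hence not positive shortly after it. -/
theorem forall_pos_of_decelerating {u v h : ℝ → ℝ} (hab : a ≤ b)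
    (hu : AbsolutelyContinuousOnInterval u a b) (hv : AbsolutelyContinuousOnInterval v a b)
    (hh : ContinuousOn h (Icc a b))
    (hae : ∀ᵐ t : ℝ, t ∈ Icc a b → HasDerivAt u (v t) t ∧
      ∃ w, HasDerivAt v w t ∧ (0 < v t → w ≤ h t))
    (hneg : ∀ t ∈ Icc a b, u t = 0 → h t < 0) (hva : v a ≤ 0) (hnonneg : ∀ t ∈ Icc a b, 0 ≤ u t)
    (hub : 0 < u b) : ∀ t ∈ Icc a b, 0 < u t := by
  by_contra! hcon
  obtain ⟨t, ht, hut⟩ := hcon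
  have huc : ContinuousOn u (Icc a b) := uIcc_of_le hab ▸ hu.continuousOn
  have hvc : ContinuousOn v (Icc a b) := uIcc_of_le hab ▸ hv.continuousOn
  have hmono : ∀ {f : ℝ → ℝ} {s t : ℝ}, AbsolutelyContinuousOnInterval f a b → a ≤ s → s ≤ t →
      t ≤ b → AbsolutelyContinuousOnInterval f s t := fun hf h1 h2 h3 ↦
    hf.mono (by rw [uIcc_of_le h2, uIcc_of_le hab]; exact Icc_subset_Icc h1 h3)
  obtain ⟨r, ⟨hr, hur⟩, hmax⟩ : ∃ r, IsGreatest (Icc a b ∩ u ⁻¹' Iic 0) r :=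
    (isCompact_Icc.of_isClosed_subset (huc.preimage_isClosed_of_isClosed isClosed_Icc isClosed_Iic)
      inter_subset_left).exists_isGreatest ⟨t, ht, hut⟩
  have hur0 : u r = 0 := le_antisymm hur (hnonneg r hr)
  have hrb : r < b := hr.2.lt_of_ne (by rintro rfl; linarith)
  -- a positive velocity at `r` would mean that `u < 0` shortly before `r`
  have hvr : v r ≤ 0 := by
    by_contra! hpos
    have har : a < r := hr.1.lt_of_ne (by rintro rfl; linarith)
    obtain ⟨δ, hδ, hδv⟩ := Metric.continuousOn_iff.1 hvc r hr (v r / 2) (by linarith)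
    set σ := max a (r - δ / 2) with hσ
    have hσr : σ < r := max_lt har (by linarith)
    have hσa : a ≤ σ := le_max_left _ _
    have hσδ : r - δ / 2 ≤ σ := le_max_right _ _
    have := (hmono hu.neg hσa hσr.le hr.2).sub_le_of_ae_hasDerivAt_le (v := -(v r / 2)) hσr.le (by
      filter_upwards [hae] with τ hτ hmem
      have hτI : τ ∈ Icc a b := ⟨hσa.trans hmem.1, hmem.2.trans hr.2⟩
      have h1 := hδv τ hτI (by
        rw [Real.dist_eq, abs_lt]
        constructor <;> linarith [hmem.1, hmem.2])
      rw [Real.dist_eq, abs_lt] at h1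
      exact ⟨_, by linarith [h1.1], (hτ hτI).1.neg⟩)
    simp only [Pi.neg_apply] at this
    nlinarith [hnonneg σ ⟨hσa, hσr.le.trans hr.2⟩, mul_pos hpos (sub_pos.2 hσr)]
  obtain ⟨δ, hδ, hδh⟩ := Metric.continuousOn_iff.1 hh r hr (-h r) (by linarith [hneg r hr hur0])
  set r' := min b (r + δ / 2) with hr'
  have hrr' : r < r' := lt_min hrb (by linarith)
  have hr'b : r' ≤ b := min_le_left _ _
  have hr'δ : r' ≤ r + δ / 2 := min_le_right _ _
  have hv_nonpos : ∀ τ ∈ Icc r r', v τ ≤ 0 := by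
    intro τ hτ
    by_contra! hpos
    have hsub : Icc r τ ⊆ Icc a b := Icc_subset_Icc hr.1 (hτ.2.trans hr'b)
    -- from the last time `σ` before `τ` with `v σ ≤ 0` the velocity is positive, so it decreases
    obtain ⟨σ, ⟨hσ, hvσ⟩, hσmax⟩ : ∃ σ, IsGreatest (Icc r τ ∩ v ⁻¹' Iic 0) σ :=
      (isCompact_Icc.of_isClosed_subset
        ((hvc.mono hsub).preimage_isClosed_of_isClosed isClosed_Icc isClosed_Iic)
        inter_subset_left).exists_isGreatest ⟨r, ⟨le_rfl, hτ.1⟩, hvr⟩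
    have hvσ : v σ ≤ 0 := hvσ
    have hne : ∀ᵐ t : ℝ, t ≠ σ := by simp [ae_iff, measure_singleton]
    have := (hmono hv (hr.1.trans hσ.1) hσ.2 (hτ.2.trans hr'b)).sub_le_of_ae_hasDerivAt_le
      (v := 0) hσ.2 (by
        filter_upwards [hae, hne] with t ht hne hmem
        have htr : t ∈ Icc r τ := ⟨hσ.1.trans hmem.1, hmem.2⟩
        obtain ⟨-, w, hw, hle⟩ := ht (hsub htr)
        have hvt : 0 < v t := by
          by_contra! hvt
          exact hne (le_antisymm (hσmax ⟨htr, hvt⟩) hmem.1)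
        have h1 := hδh t (hsub htr) (by
          rw [Real.dist_eq, abs_lt]
          constructor <;> linarith [htr.1, htr.2, hτ.2])
        rw [Real.dist_eq, abs_lt] at h1
        exact ⟨w, by linarith [hle hvt, h1.2], hw⟩)
    linarith
  have hr'I : r' ∈ Icc a b := ⟨hr.1.trans hrr'.le, hr'b⟩
  have := (hmono hu hr.1 hrr'.le hr'b).sub_le_of_ae_hasDerivAt_le (v := 0) hrr'.le (by
    filter_upwards [hae] with t ht hmem
    exact ⟨_, hv_nonpos t hmem, (ht ⟨hr.1.trans hmem.1, hmem.2.trans hr'b⟩).1⟩)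
  exact hrr'.not_ge (hmax ⟨hr'I, show u r' ≤ 0 by linarith⟩)

/-- A trajectory that starts at rest in `[lo, hi]` and leaves this interval does so in one of two
ways: it passes `hi` without having touched `lo`, or `lo` without having touched `hi`. -/
theorem IsFrictionLaw.escape (hAC : IsFrictionLaw A C) {lo hi : ℝ}
    (hlo : ∀ t, A lo t < 0) (hhi : ∀ t, 0 < A hi t)
    (h : ∀ b ≥ a, IsFrictionSolution A C 0 a b q p) (hq : q a ∈ Icc lo hi) (hp : p a = 0) {T : ℝ}
    (hT : a ≤ T) (hqT : q T ∉ Icc lo hi) :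
    (∃ T ≥ a, hi < q T ∧ ∀ t ∈ Icc a T, lo < q t) ∨
      (∃ T ≥ a, q T < lo ∧ ∀ t ∈ Icc a T, q t < hi) := by
  set S : Set ℝ := {t | a ≤ t ∧ q t ∉ Icc lo hi} with hS
  have hne : S.Nonempty := ⟨T, hT, hqT⟩
  have hbdd : BddBelow S := ⟨a, fun t ht ↦ ht.1⟩
  set σ := sInf S with hσ
  have haσ : a ≤ σ := le_csInf hne fun t ht ↦ ht.1
  have hbefore : ∀ t, a ≤ t → t < σ → q t ∈ Icc lo hi := fun t h1 h2 ↦ by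
    by_contra h3
    exact (csInf_le hbdd ⟨h1, h3⟩).not_gt h2
  have hcont : ContinuousOn q (Icc a (σ + 1)) := (h _ (by linarith)).continuousOn_fst (by linarith)
  have hqσ : q σ ∈ Icc lo hi := by
    rcases haσ.eq_or_lt with h1 | h1
    · rwa [← h1]
    · have h2 : ContinuousWithinAt q (Ico a σ) σ :=
        (hcont σ ⟨haσ, by linarith⟩).mono fun t ht ↦ ⟨ht.1, by linarith [ht.2]⟩
      have h3 : σ ∈ closure (Ico a σ) := by
        rw [closure_Ico h1.ne]; exact ⟨haσ, le_rfl⟩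
      have h4 := h2.mem_closure h3 (t := Icc lo hi) fun t ht ↦ hbefore t ht.1 ht.2
      rwa [isClosed_Icc.closure_eq] at h4
  have hupto : ∀ t ∈ Icc a σ, q t ∈ Icc lo hi := fun t ht ↦ by
    rcases ht.2.eq_or_lt with h1 | h1
    · rwa [h1]
    · exact hbefore t ht.1 h1
  -- escape times arbitrarily close to `σ`, up to which an open condition at `σ` persists
  have hescape : ∀ O : Set ℝ, IsOpen O → q σ ∈ O →
      ∃ T > σ, q T ∉ Icc lo hi ∧ ∀ t ∈ Icc σ T, q t ∈ O := by
    intro O hO hmem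
    have h1 := (hcont σ ⟨haσ, by linarith⟩) (hO.mem_nhds hmem)
    obtain ⟨δ, hδ, hsub⟩ := Metric.mem_nhdsWithin_iff.1 (mem_map.1 h1)
    obtain ⟨T, hTS, hTδ⟩ := exists_lt_of_csInf_lt hne
      (show sInf S < σ + min δ 1 from lt_add_of_pos_right _ (lt_min hδ one_pos))
    have hσT : σ ≤ T := csInf_le hbdd hTS
    have hne' : σ ≠ T := by
      rintro h3
      exact hTS.2 (h3 ▸ hqσ)
    refine ⟨T, hσT.lt_of_ne hne', hTS.2, fun t ht ↦ hsub ⟨?_, haσ.trans ht.1, ?_⟩⟩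
    · rw [Metric.mem_ball, Real.dist_eq, abs_lt]
      constructor <;> linarith [ht.1, ht.2, min_le_left δ 1]
    · linarith [ht.2, min_le_right δ 1]
  have hsol := h σ haσ
  have hqc := hsol.continuousOn_fst haσ
  have hAc : ContinuousOn (fun t ↦ A (q t) t) (Icc a σ) :=
    hAC.continuous_drift.comp_continuousOn (hqc.prodMk continuousOn_id)
  have hC0 := hAC.friction_nonneg
  rcases hqσ.1.eq_or_lt with hlow | hlow
  · have hlohi : lo < hi := by
      refine (hq.1.trans hq.2).lt_of_ne fun h1 ↦ ?_
      have := hlo a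
      rw [h1] at this
      exact lt_asymm this (hhi a)
    have hqhi : q σ < hi := by rwa [← hlow]
    have key := forall_pos_of_decelerating (u := fun t ↦ hi - q t) (v := -p)
      (h := fun t ↦ -A (q t) t) haσ
      ((contDiff_const.absolutelyContinuousOnInterval a σ).fun_sub hsol.ac_fst) hsol.ac_snd.neg
      hAc.neg (by
        filter_upwards [hsol.ae_hasDerivAt] with t ht hmem
        obtain ⟨h1, s, hs, hd⟩ := ht hmem
        refine ⟨h1.const_sub hi, _, hd.neg, fun h2 ↦ ?_⟩
        rw [hs.eq_neg_one (by simpa using h2)]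
        linarith [hC0 (q t) (p t) t])
      (fun t _ h1 ↦ by
        have : q t = hi := by linarith
        simpa [this] using hhi t)
      (by simp [hp]) (fun t ht ↦ sub_nonneg.2 (hupto t ht).2) (sub_pos.2 hqhi)
    obtain ⟨T, hσT, hqT, hO⟩ := hescape (Iio hi) isOpen_Iio hqhi
    refine Or.inr ⟨T, haσ.trans hσT.le, ?_, fun t ht ↦ ?_⟩
    · by_contra! h1
      exact hqT ⟨h1, (hO T ⟨hσT.le, le_rfl⟩).le⟩
    · rcases le_total t σ with h1 | h1
      · exact sub_pos.1 (key t ⟨ht.1, h1⟩)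
      · exact hO t ⟨h1, ht.2⟩
  · have key := forall_pos_of_decelerating (u := fun t ↦ q t - lo) (v := p)
      (h := fun t ↦ A (q t) t) haσ
      (hsol.ac_fst.fun_sub (contDiff_const.absolutelyContinuousOnInterval a σ)) hsol.ac_snd
      hAc (by
        filter_upwards [hsol.ae_hasDerivAt] with t ht hmem
        obtain ⟨h1, s, hs, hd⟩ := ht hmem
        refine ⟨h1.sub_const lo, _, hd, fun h2 ↦ ?_⟩
        rw [hs.eq_one h2]
        linarith [hC0 (q t) (p t) t])
      (fun t _ h1 ↦ by
        have : q t = lo := by linarith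
        simpa [this] using hlo t)
      hp.le (fun t ht ↦ sub_nonneg.2 (hupto t ht).1) (sub_pos.2 hlow)
    obtain ⟨T, hσT, hqT, hO⟩ := hescape (Ioi lo) isOpen_Ioi hlow
    refine Or.inl ⟨T, haσ.trans hσT.le, ?_, fun t ht ↦ ?_⟩
    · by_contra! h1
      exact hqT ⟨(hO T ⟨hσT.le, le_rfl⟩).le, h1⟩
    · rcases le_total t σ with h1 | h1
      · exact sub_pos.1 (key t ⟨ht.1, h1⟩)
      · exact hO t ⟨h1, ht.2⟩

/-- **Shooting argument**: between a level `lo` at which `A` points down and a level `hi` at which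
it points up there is a trajectory that starts at rest and stays between the two forever. -/
theorem IsFrictionLaw.exists_trapped_solution (hAC : IsFrictionLaw A C) {lo hi : ℝ}
    (hlohi : lo ≤ hi) (hlo : ∀ t, A lo t < 0) (hhi : ∀ t, 0 < A hi t) (a : ℝ) :
    ∃ q₀ ∈ Icc lo hi, ∃ q p : ℝ → ℝ, q a = q₀ ∧ p a = 0 ∧
      (∀ b ≥ a, IsFrictionSolution A C 0 a b q p) ∧ ∀ t ≥ a, q t ∈ Icc lo hi := by
  choose q p hq hp hsol using fun q₀ ↦ hAC.exists_solution a q₀ 0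
  by_contra! hcon
  set U : Set ℝ := {x | ∃ T ≥ a, hi < q x T ∧ ∀ t ∈ Icc a T, lo < q x t} with hU
  set V : Set ℝ := {x | ∃ T ≥ a, q x T < lo ∧ ∀ t ∈ Icc a T, q x t < hi} with hV
  have hcover : Icc lo hi ⊆ U ∪ V := by
    intro x hx
    obtain ⟨T, hT, hqT⟩ := hcon x hx (q x) (p x) (hq x) (hp x) (hsol x)
    exact hAC.escape hlo hhi (hsol x) (by rwa [hq]) (hp x) hT hqT
  -- continuous dependence on the initial state, uniformly on `[a, T]`
  have hnear : ∀ T ≥ a, ∀ x, ∀ η > 0, ∀ᶠ y in 𝓝 x, ∀ t ∈ Icc a T, |q y t - q x t| < η := by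
    intro T hT x η hη
    obtain ⟨L, hL0, hL⟩ := hAC.comparison a T 0
    have h1 : Tendsto (fun y ↦ L * (y - x) ^ 2) (𝓝 x) (𝓝 (L * (x - x) ^ 2)) :=
      Continuous.tendsto (by fun_prop) x
    rw [sub_self, zero_pow two_ne_zero, mul_zero] at h1
    filter_upwards [h1.eventually_lt_const (by positivity : 0 < η ^ 2)] with y hy t ht
    have h2 := hL 0 0 _ _ _ _ t ht le_rfl le_rfl (hsol y t ht.1) (hsol x t ht.1)
      (by simp [hp]) (by simp [hp])
    rw [hq, hq, hp, hp, sub_self, zero_pow two_ne_zero, add_zero, add_zero, add_zero] at h2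
    refine abs_lt_of_sq_lt_sq ?_ hη.le
    linarith [sq_nonneg (p y t - p x t)]
  have hUo : IsOpen U := by
    rw [isOpen_iff_mem_nhds]
    rintro x ⟨T, hT, hqT, hpos⟩
    obtain ⟨t₁, ht₁, hmin⟩ := isCompact_Icc.exists_isMinOn (nonempty_Icc.2 hT)
      ((hsol x T hT).continuousOn_fst hT)
    filter_upwards [hnear T hT x _ (sub_pos.2 hqT), hnear T hT x _ (sub_pos.2 (hpos t₁ ht₁))]
      with y h1 h2
    refine ⟨T, hT, ?_, fun t ht ↦ ?_⟩
    · linarith [(abs_lt.1 (h1 T ⟨hT, le_rfl⟩)).1]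
    · linarith [(abs_lt.1 (h2 t ht)).1, isMinOn_iff.1 hmin t ht]
  have hVo : IsOpen V := by
    rw [isOpen_iff_mem_nhds]
    rintro x ⟨T, hT, hqT, hneg⟩
    obtain ⟨t₁, ht₁, hmax⟩ := isCompact_Icc.exists_isMaxOn (nonempty_Icc.2 hT)
      ((hsol x T hT).continuousOn_fst hT)
    filter_upwards [hnear T hT x _ (sub_pos.2 hqT), hnear T hT x _ (sub_pos.2 (hneg t₁ ht₁))]
      with y h1 h2
    refine ⟨T, hT, ?_, fun t ht ↦ ?_⟩
    · linarith [(abs_lt.1 (h1 T ⟨hT, le_rfl⟩)).2]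
    · linarith [(abs_lt.1 (h2 t ht)).2, isMaxOn_iff.1 hmax t ht]
  have hhiU : hi ∈ U := (hcover ⟨hlohi, le_rfl⟩).resolve_right fun ⟨T, hT, _, h⟩ ↦
    (h a ⟨le_rfl, hT⟩).ne (hq hi)
  have hloV : lo ∈ V := (hcover ⟨le_rfl, hlohi⟩).resolve_left fun ⟨T, hT, _, h⟩ ↦
    (h a ⟨le_rfl, hT⟩).ne' (hq lo)
  obtain ⟨x, -, ⟨T, hT, hqT, hpos⟩, T', hT', hqT', hneg⟩ := isPreconnected_Icc U V hUo hVo hcover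
    ⟨hi, ⟨hlohi, le_rfl⟩, hhiU⟩ ⟨lo, ⟨le_rfl, hlohi⟩, hloV⟩
  rcases le_total T T' with h | h
  · exact lt_asymm hqT (hneg T ⟨hT, h⟩)
  · exact lt_asymm hqT' (hpos T' ⟨hT', h⟩)

/-! ### The set-valued right-hand side -/

/-- If the friction acts with the constant sign `s` on the side `s p > 0` of the plane `p = 0`, then
the corresponding value is a limit value at the points of this side and of the plane itself. Only
`s = 1` and `s = -1` occur below. -/
theorem mem_filippov_of_sign {f : ℝ × ℝ → ℝ → ℝ × ℝ} {x : ℝ × ℝ} {t s : ℝ} (hs : s ≠ 0)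
    (hf : ∀ z : ℝ × ℝ, 0 < s * z.2 → f z t = (z.2, A z.1 t - C z.1 z.2 t * s))
    (hAC : IsFrictionLaw A C) (hx : 0 ≤ s * x.2) :
    (x.2, A x.1 t - C x.1 x.2 t * s) ∈ filippov f pendulumPlane x t := by
  refine subset_closedConvexHull ?_
  let z : ℕ → ℝ × ℝ := fun n ↦ (x.1, x.2 + s * (1 / ((n : ℝ) + 1)))
  have hz : ∀ n, 0 < s * (z n).2 := fun n ↦ by
    have h1 : 0 < s * s * (1 / ((n : ℝ) + 1)) := mul_pos (mul_self_pos.2 hs) (by positivity)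
    simp only [z]
    nlinarith
  have hlim : Tendsto z atTop (𝓝 x) := by
    have h1 := (tendsto_one_div_add_atTop_nhds_zero_nat (𝕜 := ℝ)).const_mul s
    simpa [z] using (tendsto_const_nhds (x := x.1)).prodMk_nhds (h1.const_add x.2)
  have hlim' : Tendsto z atTop (𝓝[{y | (y, t) ∉ pendulumPlane}] x) :=
    tendsto_nhdsWithin_iff.2 ⟨hlim, .of_forall fun n (h : (z n).2 = 0) ↦ by
      simpa [h] using hz n⟩
  refine MapClusterPt.of_comp hlim' (Tendsto.mapClusterPt ?_)
  have hcont : Continuous fun y : ℝ × ℝ ↦ (y.2, A y.1 t - C y.1 y.2 t * s) := by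
    refine continuous_snd.prodMk (Continuous.sub ?_ (Continuous.mul ?_ continuous_const))
    · exact hAC.continuous_drift.comp (f := fun y : ℝ × ℝ ↦ (y.1, t)) (by fun_prop)
    · exact hAC.continuous_friction.comp (f := fun y : ℝ × ℝ ↦ (y.1, y.2, t)) (by fun_prop)
  refine ((hcont.tendsto x).comp hlim).congr fun n ↦ ?_
  exact (hf _ (hz n)).symm

/-- Filippov's regularization of dry friction replaces the sign of `p` by the set-valued sign. -/
theorem IsFrictionLaw.mem_filippov_iff (hAC : IsFrictionLaw A C) {f : ℝ × ℝ → ℝ → ℝ × ℝ}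
    (hf : ∀ z t, f z t = (z.2, A z.1 t - C z.1 z.2 t * (z.2 / |z.2|))) {x v : ℝ × ℝ} {t : ℝ} :
    v ∈ filippov f pendulumPlane x t ↔
      v.1 = x.2 ∧ ∃ s, IsSign 0 s x.2 ∧ v.2 = A x.1 t - C x.1 x.2 t * s := by
  have hC0 := hAC.friction_nonneg
  constructor
  · intro hv
    rw [exists_isSign_iff (hC0 _ _ _)]
    set α := A x.1 t
    set c := C x.1 x.2 t
    let S : Set (ℝ × ℝ) := {x.2} ×ˢ ((Icc (α - c) (α + c) ∩ {w | 0 < x.2 → w ≤ α - c}) ∩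
      {w | x.2 < 0 → α + c ≤ w})
    suffices h : filippov f pendulumPlane x t ⊆ S by
      obtain ⟨h1, ⟨⟨h2, h3⟩, h4⟩, h5⟩ := h hv
      exact ⟨h1, h2, h3, h4, h5⟩
    refine closedConvexHull_min ?_ ?_ ?_
    · rintro y hy
      obtain ⟨F, hF, hFy⟩ := mapClusterPt_iff_ultrafilter.1 hy
      have hFx : Tendsto id (F : Filter (ℝ × ℝ)) (𝓝 x) := hF.trans nhdsWithin_le_nhds
      have hA : Tendsto (fun z : ℝ × ℝ ↦ A z.1 t) F (𝓝 α) :=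
        ((hAC.continuous_drift.comp (f := fun y : ℝ × ℝ ↦ (y.1, t)) (by fun_prop)).tendsto x).comp
          hFx
      have hC : Tendsto (fun z : ℝ × ℝ ↦ C z.1 z.2 t) F (𝓝 c) :=
        ((hAC.continuous_friction.comp (f := fun y : ℝ × ℝ ↦ (y.1, y.2, t))
          (by fun_prop)).tendsto x).comp hFx
      have hp : Tendsto (fun z : ℝ × ℝ ↦ z.2) F (𝓝 x.2) := (continuous_snd.tendsto x).comp hFx
      have hy1 : Tendsto (fun z ↦ (f z t).1) F (𝓝 y.1) := (continuous_fst.tendsto y).comp hFy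
      have hy2 : Tendsto (fun z ↦ (f z t).2) F (𝓝 y.2) := (continuous_snd.tendsto y).comp hFy
      have hsgn : ∀ z : ℝ × ℝ, abs (z.2 / |z.2|) ≤ 1 := fun z ↦ by
        rw [abs_div, abs_abs]; exact div_self_le_one _
      refine ⟨?_, ⟨⟨?_, ?_⟩, fun hx ↦ ?_⟩, fun hx ↦ ?_⟩
      · exact tendsto_nhds_unique hy1 (hp.congr fun z ↦ by rw [hf])
      · refine le_of_tendsto_of_tendsto' (hA.sub hC) hy2 fun z ↦ ?_
        rw [hf]
        nlinarith [hC0 z.1 z.2 t, (abs_le.1 (hsgn z)).2]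
      · refine le_of_tendsto_of_tendsto' hy2 (hA.add hC) fun z ↦ ?_
        rw [hf]
        nlinarith [hC0 z.1 z.2 t, (abs_le.1 (hsgn z)).1]
      · refine le_of_tendsto_of_tendsto hy2 (hA.sub hC) ?_
        filter_upwards [hp.eventually_const_lt hx] with z hz
        rw [hf, abs_of_pos hz, div_self hz.ne', mul_one]
      · refine le_of_tendsto_of_tendsto (hA.add hC) hy2 ?_
        filter_upwards [hp.eventually_lt_const hx] with z hz
        rw [hf, abs_of_neg hz, div_neg, div_self hz.ne]
        linarith
    · refine (convex_singleton _).prod (((convex_Icc _ _).inter ?_).inter ?_)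
      · by_cases hx : 0 < x.2 <;> simp only [hx, forall_const, IsEmpty.forall_iff]
        exacts [convex_Iic _, convex_univ]
      · by_cases hx : x.2 < 0 <;> simp only [hx, forall_const, IsEmpty.forall_iff]
        exacts [convex_Ici _, convex_univ]
    · refine isClosed_singleton.prod ((isClosed_Icc.inter ?_).inter ?_)
      · by_cases hx : 0 < x.2 <;> simp only [hx, forall_const, IsEmpty.forall_iff]
        exacts [isClosed_Iic, isClosed_univ]
      · by_cases hx : x.2 < 0 <;> simp only [hx, forall_const, IsEmpty.forall_iff]
        exacts [isClosed_Ici, isClosed_univ]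
  · rintro ⟨hv1, s, hs, hv2⟩
    obtain ⟨h1, h2⟩ := abs_le.1 hs.abs_le_one
    have hpos : 0 ≤ x.2 → (x.2, A x.1 t - C x.1 x.2 t * 1) ∈ filippov f pendulumPlane x t :=
      fun hx ↦ mem_filippov_of_sign one_ne_zero (fun z hz ↦ by
        rw [one_mul] at hz
        rw [hf, abs_of_pos hz, div_self hz.ne']) hAC (by linarith)
    have hneg : x.2 ≤ 0 → (x.2, A x.1 t - C x.1 x.2 t * (-1)) ∈ filippov f pendulumPlane x t :=
      fun hx ↦ mem_filippov_of_sign (by norm_num) (fun z hz ↦ by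
        have hz : z.2 < 0 := by linarith
        rw [hf, abs_of_neg hz, div_neg, div_self hz.ne]) hAC (by linarith)
    have hv : v = (x.2, A x.1 t - C x.1 x.2 t * s) := Prod.ext hv1 hv2
    rw [hv]
    rcases lt_trichotomy x.2 0 with hx | hx | hx
    · rw [hs.eq_neg_one hx]; exact hneg hx.le
    · have := convex_closedConvexHull (hpos hx.ge) (hneg hx.le)
        (show 0 ≤ (1 + s) / 2 by linarith) (show 0 ≤ (1 - s) / 2 by linarith) (by ring)
      convert (show _ ∈ filippov f pendulumPlane x t from this) using 1
      rw [Prod.smul_mk, Prod.smul_mk, Prod.mk_add_mk]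
      simp only [smul_eq_mul]
      congr 1 <;> ring
    · rw [hs.eq_one hx]; exact hpos hx.le

/-! ### The pendulum -/

/-- The angular acceleration of the pendulum without friction, `w` being the acceleration of the
pivot. -/
noncomputable def pendulumDrift (l g : ℝ) (w : ℝ → ℝ) (q t : ℝ) : ℝ :=
  w t / l * Real.sin q - g / l * Real.cos q

/-- The magnitude of the angular acceleration that is due to the friction. -/
noncomputable def pendulumFriction (l g μ : ℝ) (w : ℝ → ℝ) (q p t : ℝ) : ℝ :=
  μ / l * |w t * Real.cos q - l * p ^ 2 + g * Real.sin q|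

theorem abs_mul_add_mul_le {x y u v U V : ℝ} (hU : |u| ≤ U) (hV : |v| ≤ V) :
    |u * x + v * y| ≤ U * |x| + V * |y| := by
  refine (abs_add_le _ _).trans ?_
  rw [abs_mul, abs_mul]
  gcongr

theorem isFrictionLaw_pendulum {l g μ : ℝ} (hl : 0 < l) (hg : 0 < g) (hμ : 0 < μ) {w : ℝ → ℝ}
    (hw : Continuous w) : IsFrictionLaw (pendulumDrift l g w) (pendulumFriction l g μ w) := by
  have hbdd : ∀ a b, ∃ W, 0 ≤ W ∧ ∀ t ∈ Icc a b, |w t| ≤ W := by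
    intro a b
    obtain ⟨W, hW⟩ := isCompact_Icc.exists_bound_of_continuousOn (s := Icc a b) hw.continuousOn
    exact ⟨max W 0, le_max_right _ _, fun t ht ↦ (hW t ht).trans (le_max_left _ _)⟩
  have hdrift : ∀ {W t : ℝ}, |w t| ≤ W → ∀ x y : ℝ,
      |w t / l * x - g / l * y| ≤ W / l * |x| + g / l * |y| := by
    intro W t hW x y
    rw [sub_eq_add_neg, ← neg_mul]
    refine abs_mul_add_mul_le ?_ ?_
    · rw [abs_div, abs_of_pos hl]; gcongr
    · rw [abs_neg, abs_of_pos (by positivity)]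
  have hforce : ∀ {W t : ℝ}, |w t| ≤ W → ∀ x y z : ℝ,
      |w t * x - l * y + g * z| ≤ W * |x| + l * |y| + g * |z| := by
    intro W t hW x y z
    have h1 := abs_mul_add_mul_le (x := x) (y := y) hW (show |-l| ≤ l by rw [abs_neg, abs_of_pos hl])
    have h2 := abs_add_le (w t * x + -l * y) (g * z)
    rw [abs_mul g, abs_of_pos hg] at h2
    rw [sub_eq_add_neg, ← neg_mul]
    linarith
  refine ⟨?_, ?_, ?_, ?_, ?_⟩
  · unfold pendulumDrift; fun_prop
  · unfold pendulumFriction; fun_prop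
  · intro q p t
    unfold pendulumFriction
    positivity
  · intro a b
    obtain ⟨W, hW0, hW⟩ := hbdd a b
    refine ⟨W / l + g / l, by positivity, fun t ht q ↦ (hdrift (hW t ht) _ _).trans ?_⟩
    exact add_le_add (mul_le_of_le_one_right (by positivity) (Real.abs_sin_le_one q))
      (mul_le_of_le_one_right (by positivity) (Real.abs_cos_le_one q))
  · intro a b P
    obtain ⟨W, hW0, hW⟩ := hbdd a b
    have hK1 : 0 ≤ W / l + g / l := by positivity
    have hK2 : 0 ≤ μ / l * (W + l * (2 * |P|) + g) := by positivity
    have hK3 : 0 ≤ μ / l * (W + l * P ^ 2 + g) := by positivity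
    refine ⟨(W / l + g / l) + μ / l * (W + l * (2 * |P|) + g) + μ / l * (W + l * P ^ 2 + g),
      by positivity, fun t ht q q' p p' hp hp' ↦ ⟨?_, ?_, ?_⟩⟩
    · have hsin := Real.abs_sin_sub_sin_le q q'
      have hcos := Real.abs_cos_sub_cos_le q q'
      have h1 : pendulumDrift l g w q t - pendulumDrift l g w q' t =
          w t / l * (Real.sin q - Real.sin q') - g / l * (Real.cos q - Real.cos q') := by
        unfold pendulumDrift; ring
      rw [h1]
      calc _ ≤ W / l * |Real.sin q - Real.sin q'| + g / l * |Real.cos q - Real.cos q'| :=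
            hdrift (hW t ht) _ _
        _ ≤ W / l * |q - q'| + g / l * |q - q'| := by
            gcongr
        _ = (W / l + g / l) * |q - q'| := by ring
        _ ≤ _ := mul_le_mul_of_nonneg_right (by linarith) (abs_nonneg _)
    · have hsin := Real.abs_sin_sub_sin_le q q'
      have hcos := Real.abs_cos_sub_cos_le q q'
      have h1 : |p ^ 2 - p' ^ 2| ≤ 2 * |P| * |p - p'| := by
        rw [sq_sub_sq, abs_mul]
        gcongr
        have := abs_add_le p p'
        have := le_abs_self P
        linarith
      unfold pendulumFriction
      rw [← mul_sub, abs_mul, abs_of_pos (by positivity : 0 < μ / l)]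
      calc _ ≤ μ / l * |(w t * Real.cos q - l * p ^ 2 + g * Real.sin q) -
              (w t * Real.cos q' - l * p' ^ 2 + g * Real.sin q')| := by
            exact mul_le_mul_of_nonneg_left (abs_abs_sub_abs_le_abs_sub _ _) (by positivity)
        _ = μ / l * |w t * (Real.cos q - Real.cos q') - l * (p ^ 2 - p' ^ 2) +
              g * (Real.sin q - Real.sin q')| := by ring_nf
        _ ≤ μ / l * (W * |q - q'| + l * (2 * |P| * |p - p'|) + g * |q - q'|) := by
            gcongr
            refine (hforce (hW t ht) _ _ _).trans ?_
            gcongr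
        _ ≤ μ / l * ((W + l * (2 * |P|) + g) * (|q - q'| + |p - p'|)) := by
            gcongr
            have e1 : 0 ≤ (W + g) * |p - p'| := by positivity
            have e2 : 0 ≤ l * (2 * |P|) * |q - q'| := by positivity
            linarith
        _ = μ / l * (W + l * (2 * |P|) + g) * (|q - q'| + |p - p'|) := by ring
        _ ≤ _ := mul_le_mul_of_nonneg_right (by linarith) (by positivity)
    · have h1 : |p ^ 2| ≤ P ^ 2 := by
        rw [abs_of_nonneg (sq_nonneg p), ← sq_abs]; gcongr
      have h2 : pendulumFriction l g μ w q p t ≤ μ / l * (W + l * P ^ 2 + g) := by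
        unfold pendulumFriction
        gcongr
        refine (hforce (hW t ht) _ _ _).trans ?_
        gcongr
        · exact mul_le_of_le_one_right hW0 (Real.abs_cos_le_one q)
        · exact mul_le_of_le_one_right hg.le (Real.abs_sin_le_one q)
      linarith

theorem pendulumField_eq (l g μ : ℝ) (ξ : ℝ → ℝ) (z : ℝ × ℝ) (t : ℝ) :
    pendulumField l g μ ξ z t = (z.2, pendulumDrift l g (deriv (deriv ξ)) z.1 t -
      pendulumFriction l g μ (deriv (deriv ξ)) z.1 z.2 t * (z.2 / |z.2|)) := by
  unfold pendulumField pendulumDrift pendulumFriction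
  ext
  · rfl
  · ring

section

variable {l g μ : ℝ} {ξ : ℝ → ℝ}

theorem mem_filippov_pendulumField_iff
    (hAC : IsFrictionLaw (pendulumDrift l g (deriv (deriv ξ)))
      (pendulumFriction l g μ (deriv (deriv ξ)))) {x v : ℝ × ℝ} {t : ℝ} :
    v ∈ filippov (pendulumField l g μ ξ) pendulumPlane x t ↔
      v.1 = x.2 ∧ ∃ s, IsSign 0 s x.2 ∧ v.2 = pendulumDrift l g (deriv (deriv ξ)) x.1 t -
        pendulumFriction l g μ (deriv (deriv ξ)) x.1 x.2 t * s :=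
  hAC.mem_filippov_iff (pendulumField_eq l g μ ξ)

theorem IsPendulumSolution.isFrictionSolution
    (hAC : IsFrictionLaw (pendulumDrift l g (deriv (deriv ξ)))
      (pendulumFriction l g μ (deriv (deriv ξ)))) {I : Set ℝ} {x : ℝ → ℝ × ℝ}
    (hx : IsPendulumSolution l g μ ξ I x) {a b : ℝ} (ha : a ∈ I) (hb : b ∈ I) :
    IsFrictionSolution (pendulumDrift l g (deriv (deriv ξ)))
      (pendulumFriction l g μ (deriv (deriv ξ))) 0 a b (fun t ↦ (x t).1) (fun t ↦ (x t).2) := by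
  obtain ⟨hI, hac, hae⟩ := hx
  refine ⟨(hac a ha b hb).fst, (hac a ha b hb).snd, ?_⟩
  filter_upwards [hae] with t ht hmem
  obtain ⟨v, hv, hd⟩ := ht (hI.out ha hb hmem)
  obtain ⟨h1, s, hs, h2⟩ := (mem_filippov_pendulumField_iff hAC).1 hv
  exact ⟨h1 ▸ hd.fst, s, hs, h2 ▸ hd.snd⟩

theorem isPendulumSolution_Ici
    (hAC : IsFrictionLaw (pendulumDrift l g (deriv (deriv ξ)))
      (pendulumFriction l g μ (deriv (deriv ξ)))) {a : ℝ} {q p : ℝ → ℝ}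
    (h : ∀ b ≥ a, IsFrictionSolution (pendulumDrift l g (deriv (deriv ξ)))
      (pendulumFriction l g μ (deriv (deriv ξ))) 0 a b q p) :
    IsPendulumSolution l g μ ξ (Ici a) fun t ↦ (q t, p t) := by
  refine ⟨ordConnected_Ici, fun s hs t ht ↦ ?_, ?_⟩
  · have hb : a ≤ max s t := le_max_of_le_left hs
    refine ((h _ hb).ac_fst.prodMk (h _ hb).ac_snd).mono ?_
    rw [uIcc_of_le hb]
    exact Icc_subset_Icc (le_min hs ht) le_rfl
  · have hall : ∀ n : ℕ, ∀ᵐ t : ℝ, t ∈ Icc a (a + n) → _ := fun n ↦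
      (h (a + n) (le_add_of_nonneg_right n.cast_nonneg)).ae_hasDerivAt
    filter_upwards [ae_all_iff.2 hall] with t ht hat
    obtain ⟨n, hn⟩ := exists_nat_ge (t - a)
    obtain ⟨hq, s, hs, hp⟩ := ht n ⟨hat, by linarith⟩
    exact ⟨_, (mem_filippov_pendulumField_iff hAC).2 ⟨rfl, s, hs, rfl⟩, hq.prodMk hp⟩

end

/-! ### A trajectory without falling -/

theorem proposition1 (l g μ : ℝ) (hl : 0 < l) (hg : 0 < g) (hμ : 0 < μ)
    (ξ : ℝ → ℝ) (hξ : Differentiable ℝ ξ) (hξ' : Differentiable ℝ (deriv ξ))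
    (hLip : ∃ K : NNReal, LipschitzWith K (deriv (deriv ξ))) (t₀ : ℝ) :
    ∃ q₀ ∈ Set.Icc (0 : ℝ) Real.pi, ∃ p₀ : ℝ, ∃ x : ℝ → ℝ × ℝ,
      -- `x` is a solution on `[t₀, ∞)` with initial state `(q₀, p₀)`
      IsPendulumSolution l g μ ξ (Set.Ici t₀) x ∧ x t₀ = (q₀, p₀) ∧
      -- it is the solution: every solution with these initial data is a restriction of `x`
      (∀ (J : Set ℝ) (y : ℝ → ℝ × ℝ), J ⊆ Set.Ici t₀ → t₀ ∈ J →
        IsPendulumSolution l g μ ξ J y → y t₀ = (q₀, p₀) → Set.EqOn y x J) ∧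
      -- and the pendulum never falls below the horizontal
      ∀ t > t₀, (x t).1 ∈ Set.Icc (0 : ℝ) Real.pi := by
  obtain ⟨K, hK⟩ := hLip
  have hAC := isFrictionLaw_pendulum hl hg hμ hK.continuous
  have hgl : 0 < g / l := by positivity
  obtain ⟨q₀, hq₀, q, p, hq, hp, hsol, hmem⟩ := hAC.exists_trapped_solution Real.pi_pos.le
    (fun t ↦ by simpa [pendulumDrift] using hgl) (fun t ↦ by simpa [pendulumDrift] using hgl) t₀
  refine ⟨q₀, hq₀, 0, fun t ↦ (q t, p t), isPendulumSolution_Ici hAC hsol, Prod.ext hq hp, ?_,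
    fun t ht ↦ hmem t ht.le⟩
  intro J y hJ ht₀ hy hy₀ t ht
  obtain ⟨h1, h2⟩ := hAC.eqOn_of_initial_eq (hJ ht) (hy.isFrictionSolution hAC ht₀ ht)
    (hsol t (hJ ht)) (by simp [hy₀, hq]) (by simp [hy₀, hp])
  exact Prod.ext h1 h2
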